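/- **Setting.** Let $d\ge 2$ and write $\widehat f(\xi)=(2\pi)^{-d/2}\int_{\mathbb R^d}e^{-ix\cdot\xi}f(x)\,dx$, extended to $\mathcal S'(\mathbb R^d)$ by duality. Fix $\phi\in\mathcal S(\mathbb R^d)$ supported in $\{|\xi|\le 2\}$ with $\phi(\xi)=1$ for $|\xi|\le 1$, put $\psi(\xi)=\phi(\xi)-\phi(2\xi)$, and for $k\in\mathbb Z$ let $$\widehat{P_kf}(\xi)=\psi(\xi/2^k)\widehat f(\xi),\qquad \widehat{P_{\le k}f}(\xi)=\phi(\xi/2^k)\widehat f(\xi).$$ For $\lambda>0$ let $m_\lambda(\xi)=|\lambda-|\xi|^2|$, let $k_\lambda$ be the integer with $2^{k_\lambda-1}<\lambda^{1/2}\le 2^{k_\lambda}$, $I=\{k_\lambda-2,k_\lambda-1,k_\lambda,k_\lambda+1\}$ and $P_{<I}=P_{\le k_\lambda-3}$. Let $D_0=\{|x|\le 1\}$, $D_j=\{2^{j-1}<|x|\le 2^j\}$ for $j\ge 1$, and $|||g|||_*=\sup_{j\ge 0}2^{-j/2}\|g\|_{L^2(D_j)}$. The space $Y_\lambda^*$ is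 the set of $u\in\mathcal S'(\mathbb R^d)$ for which $$\|u\|_{Y_\lambda^*}^2=\|m_\lambda^{1/2}\widehat{P_{<I}u}\|_{L^2}^2+\sum_{k\in I}\lambda^{1/2}|||P_ku|||_*^2+\sum_{k>k_\lambda+1}\|m_\lambda^{1/2}\widehat{P_ku}\|_{L^2}^2<\infty$$ (a norm of a distribution that is not a function being $+\infty$). The homogeneous Besov semi-norm is $\|u\|_{\dot B^{1/2}_{2,1}}=\sum_{l\in\mathbb Z}2^{l/2}\|P_lu\|_{L^2}$. **Theorem.** 1. Let $\Gamma\subset\mathbb R^d$ be a compact hypersurface locally described by graphs of Lipschitz functions: each point of $\Gamma$ has an open neighbourhood $U$ such that, for some unit vector $\nu$ and some Lipschitz function $h:\nu^\perp\to\mathbb R$, $\Gamma\cap U=\{y+h(y)\nu: y\in\nu^\perp\}\cap U$. Let $L^2(\Gamma)$ be taken with respect to the surface measure. There is a constant $C>0$, depending only on $d$, $\Gamma$ and the fixed function $\phi$, such that $$\|f\|_{L^2(\Gamma)}\le C\,\|f\|_{Y_\lambda^*}\qquad\text{for all } f\in\mathcal S(\mathbb R^d)\text{ and all }\lambda>1.$$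 2. Let $\chi\in\mathcal S(\mathbb R^d)$ be band-limited with $\operatorname{supp}\widehat\chi\subset\{|\xi|\le 1\}$. There is a constant $C>0$, depending only on $d$, $\chi$ and $\phi$, such that $$\|\chi u\|_{\dot B^{1/2}_{2,1}}\le C\,\|u\|_{Y_\lambda^*}\qquad\text{for all } \lambda>1\text{ and all }u\in Y_\lambda^*.$$ -/

import Mathlib

open MeasureTheory Set
open scoped ENNReal NNReal SchwartzMap FourierTransform RealInnerProductSpace

noncomputable section

/-! ### The Fourier transform with the unitary angular-frequency normalisation -/

/-- The dilation `ξ ↦ c ξ` of `ℝᵈ`, for `c ≠ 0`. -/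
def dilation (d : ℕ) (c : ℝ) (hc : c ≠ 0) :
    EuclideanSpace ℝ (Fin d) ≃L[ℝ] EuclideanSpace ℝ (Fin d) :=
  ContinuousLinearEquiv.smulLeft (Units.mk0 c hc)

/-- The Fourier transform `f̂(ξ) = (2π)^(-d/2) ∫ e^(-i x·ξ) f(x) dx` on Schwartz functions, obtained
from Mathlib's Fourier transform (which has the kernel `e^(-2πi x·ξ)`) by rescaling. -/
def hatS (d : ℕ) :
    𝓢(EuclideanSpace ℝ (Fin d), ℂ) →L[ℂ] 𝓢(EuclideanSpace ℝ (Fin d), ℂ) :=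
  (((2 * Real.pi) ^ (-(d : ℝ) / 2) : ℝ) : ℂ) •
    (SchwartzMap.compCLMOfContinuousLinearEquiv ℂ
        (dilation d (2 * Real.pi)⁻¹ (inv_ne_zero Real.two_pi_pos.ne'))).comp
      (FourierTransform.fourierCLM ℂ 𝓢(EuclideanSpace ℝ (Fin d), ℂ))

/-- The explicit formula for `hatS`. -/
theorem hatS_apply {d : ℕ} (f : 𝓢(EuclideanSpace ℝ (Fin d), ℂ))
    (ξ : EuclideanSpace ℝ (Fin d)) :
    hatS d f ξ = (((2 * Real.pi) ^ (-(d : ℝ) / 2) : ℝ) : ℂ) *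
      ∫ x, Complex.exp (-(Complex.I * (⟪x, ξ⟫ : ℝ))) * f x := by
  have h : hatS d f ξ = (((2 * Real.pi) ^ (-(d : ℝ) / 2) : ℝ) : ℂ) *
      (𝓕 f) ((2 * Real.pi)⁻¹ • ξ) := rfl
  rw [h, SchwartzMap.fourier_coe, Real.fourier_eq']
  congr 1
  refine integral_congr_ae (Filter.Eventually.of_forall fun x => ?_)
  simp only [smul_eq_mul, inner_smul_right]
  congr 2
  have hpi : (Real.pi : ℂ) ≠ 0 := by exact_mod_cast Real.pi_ne_zero
  push_cast
  field_simp

/-- The Fourier transform of a tempered distribution: `⟨û, θ⟩ = ⟨u, θ̂⟩`. -/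
def hatD (d : ℕ) :
    𝓢'(EuclideanSpace ℝ (Fin d), ℂ) →L[ℂ] 𝓢'(EuclideanSpace ℝ (Fin d), ℂ) :=
  PointwiseConvergenceCLM.precomp ℂ (hatS d)

theorem hatD_apply {d : ℕ} (u : 𝓢'(EuclideanSpace ℝ (Fin d), ℂ))
    (θ : 𝓢(EuclideanSpace ℝ (Fin d), ℂ)) : hatD d u θ = u (hatS d θ) := rfl

/-! ### Littlewood-Paley projectors -/

/-- An admissible base function for the Littlewood-Paley projectors: a Schwartz function supported
in `|ξ| ≤ 2` and equal to `1` on `|ξ| ≤ 1`. -/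
def IsLPBase {d : ℕ} (φ : 𝓢(EuclideanSpace ℝ (Fin d), ℂ)) : Prop :=
  tsupport φ ⊆ Metric.closedBall 0 2 ∧ ∀ ξ, ‖ξ‖ ≤ 1 → φ ξ = 1

/-- The symbol `φ(ξ/2^k)` of `P_{≤ k}`. -/
def lowSymbol {d : ℕ} (φ : 𝓢(EuclideanSpace ℝ (Fin d), ℂ)) (k : ℤ)
    (ξ : EuclideanSpace ℝ (Fin d)) : ℂ :=
  φ (((2 : ℝ) ^ k)⁻¹ • ξ)

/-- The symbol `ψ(ξ/2^k)` of `P_k`, where `ψ(ξ) = φ(ξ) - φ(2ξ)`. -/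
def annSymbol {d : ℕ} (φ : 𝓢(EuclideanSpace ℝ (Fin d), ℂ)) (k : ℤ)
    (ξ : EuclideanSpace ℝ (Fin d)) : ℂ :=
  φ (((2 : ℝ) ^ k)⁻¹ • ξ) - φ ((2 : ℝ) • ((2 : ℝ) ^ k)⁻¹ • ξ)

theorem lowSymbol_hasTemperateGrowth {d : ℕ} (φ : 𝓢(EuclideanSpace ℝ (Fin d), ℂ)) (k : ℤ) :
    (lowSymbol φ k).HasTemperateGrowth := by
  have h := φ.hasTemperateGrowth
  unfold lowSymbol
  fun_prop

theorem annSymbol_hasTemperateGrowth {d : ℕ} (φ : 𝓢(EuclideanSpace ℝ (Fin d), ℂ)) (k : ℤ) :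
    (annSymbol φ k).HasTemperateGrowth := by
  have h := φ.hasTemperateGrowth
  unfold annSymbol
  fun_prop

/-- The Fourier multiplier with symbol `g(ξ)`, i.e. the operator `u ↦ v` with `v̂ = g û`. Mathlib's
frequency variable is `ξ/(2π)`, hence the factor `2π`. -/
def multD {d : ℕ} (g : EuclideanSpace ℝ (Fin d) → ℂ) :
    𝓢'(EuclideanSpace ℝ (Fin d), ℂ) →L[ℂ] 𝓢'(EuclideanSpace ℝ (Fin d), ℂ) :=
  TemperedDistribution.fourierMultiplierCLM ℂ fun η => g ((2 * Real.pi) • η)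

/-- `hatS` in terms of Mathlib's Fourier transform, with the dilation inside. -/
theorem hatS_eq_fourier_dilation {d : ℕ} (θ : 𝓢(EuclideanSpace ℝ (Fin d), ℂ)) :
    hatS d θ = ((((2 * Real.pi) ^ (-(d : ℝ) / 2) : ℝ) : ℂ) * (((2 * Real.pi) ^ d : ℝ) : ℂ)) •
      𝓕 (SchwartzMap.compCLMOfContinuousLinearEquiv ℂ
        (dilation d (2 * Real.pi) Real.two_pi_pos.ne') θ) := by
  ext ξ
  have h : hatS d θ ξ = (((2 * Real.pi) ^ (-(d : ℝ) / 2) : ℝ) : ℂ) *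
      (𝓕 θ) ((2 * Real.pi)⁻¹ • ξ) := rfl
  rw [h, smul_apply, smul_eq_mul, mul_assoc]
  congr 1
  rw [SchwartzMap.fourier_coe, SchwartzMap.fourier_coe, Real.fourier_eq, Real.fourier_eq]
  have hpi : (2 * Real.pi) ≠ 0 := Real.two_pi_pos.ne'
  have key := Measure.integral_comp_smul (volume : Measure (EuclideanSpace ℝ (Fin d)))
    (fun v => Real.fourierChar (-⟪v, (2 * Real.pi)⁻¹ • ξ⟫) • θ v) (2 * Real.pi)
  have hrw : ∀ v : EuclideanSpace ℝ (Fin d),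
      ⟪(2 * Real.pi) • v, (2 * Real.pi)⁻¹ • ξ⟫ = ⟪v, ξ⟫ := by
    intro v
    rw [inner_smul_left, inner_smul_right]
    simp only [RCLike.conj_to_real]
    field_simp
  simp only [hrw, finrank_euclideanSpace, Fintype.card_fin] at key
  have h2 : ∀ v : EuclideanSpace ℝ (Fin d),
      (SchwartzMap.compCLMOfContinuousLinearEquiv ℂ
        (dilation d (2 * Real.pi) Real.two_pi_pos.ne') θ) v = θ ((2 * Real.pi) • v) :=
    fun _ => rfl
  simp only [h2]
  rw [key, abs_of_pos (by positivity), Complex.real_smul, ← mul_assoc, ← Complex.ofReal_mul,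
    mul_inv_cancel₀ (by positivity), Complex.ofReal_one, one_mul]

/-- The defining relation of a Fourier multiplier. -/
theorem hatD_multD {d : ℕ} {g : EuclideanSpace ℝ (Fin d) → ℂ} (hg : g.HasTemperateGrowth)
    (u : 𝓢'(EuclideanSpace ℝ (Fin d), ℂ)) :
    hatD d (multD g u) = TemperedDistribution.smulLeftCLM ℂ g (hatD d u) := by
  have hg' : (fun η : EuclideanSpace ℝ (Fin d) => g ((2 * Real.pi) • η)).HasTemperateGrowth := by
    fun_prop
  ext θ
  simp only [hatD_apply, multD, TemperedDistribution.fourierMultiplierCLM_apply_apply,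
    TemperedDistribution.smulLeftCLM_apply_apply]
  congr 1
  have hmul : SchwartzMap.smulLeftCLM ℂ
      (fun η : EuclideanSpace ℝ (Fin d) => g ((2 * Real.pi) • η))
      (SchwartzMap.compCLMOfContinuousLinearEquiv ℂ
        (dilation d (2 * Real.pi) Real.two_pi_pos.ne') θ) =
      SchwartzMap.compCLMOfContinuousLinearEquiv ℂ
        (dilation d (2 * Real.pi) Real.two_pi_pos.ne') (SchwartzMap.smulLeftCLM ℂ g θ) := by
    ext v
    rw [SchwartzMap.smulLeftCLM_apply_apply hg']
    have h2 : ∀ τ : 𝓢(EuclideanSpace ℝ (Fin d), ℂ),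
        (SchwartzMap.compCLMOfContinuousLinearEquiv ℂ
          (dilation d (2 * Real.pi) Real.two_pi_pos.ne') τ) v = τ ((2 * Real.pi) • v) :=
      fun _ => rfl
    rw [h2, h2, SchwartzMap.smulLeftCLM_apply_apply hg]
  rw [hatS_eq_fourier_dilation, hatS_eq_fourier_dilation, FourierTransform.fourierInv_smul,
    FourierTransform.fourierInv_fourier_eq, map_smul, FourierTransform.fourier_smul, hmul]

/-- `P_{≤ k}`. -/
def lpLow {d : ℕ} (φ : 𝓢(EuclideanSpace ℝ (Fin d), ℂ)) (k : ℤ) :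
    𝓢'(EuclideanSpace ℝ (Fin d), ℂ) →L[ℂ] 𝓢'(EuclideanSpace ℝ (Fin d), ℂ) :=
  multD (lowSymbol φ k)

/-- `P_k`. -/
def lpProj {d : ℕ} (φ : 𝓢(EuclideanSpace ℝ (Fin d), ℂ)) (k : ℤ) :
    𝓢'(EuclideanSpace ℝ (Fin d), ℂ) →L[ℂ] 𝓢'(EuclideanSpace ℝ (Fin d), ℂ) :=
  multD (annSymbol φ k)

/-! ### Norms of tempered distributions -/

/-- The tempered distribution `T` is given by integration against the function `g`. -/
def Represents {d : ℕ} (T : 𝓢'(EuclideanSpace ℝ (Fin d), ℂ))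
    (g : EuclideanSpace ℝ (Fin d) → ℂ) : Prop :=
  AEStronglyMeasurable g volume ∧
    ∀ θ : 𝓢(EuclideanSpace ℝ (Fin d), ℂ),
      Integrable (fun x => θ x * g x) volume ∧ T θ = ∫ x, θ x * g x

/-- A functional `N` on (a.e. classes of) functions, extended to tempered distributions: its value
is `N g` if `T` is given by the function `g` (which is unique up to null sets), and `∞` if `T` is
not a function. -/
def distNorm {d : ℕ} (N : (EuclideanSpace ℝ (Fin d) → ℂ) → ℝ≥0∞)
    (T : 𝓢'(EuclideanSpace ℝ (Fin d), ℂ)) : ℝ≥0∞ :=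
  ⨅ (g : EuclideanSpace ℝ (Fin d) → ℂ) (_ : Represents T g), N g

/-- The dyadic shells `D_0 = {|x| ≤ 1}` and `D_j = {2^(j-1) < |x| ≤ 2^j}` for `j ≥ 1`. -/
def shell (d : ℕ) : ℕ → Set (EuclideanSpace ℝ (Fin d))
  | 0 => {x | ‖x‖ ≤ 1}
  | j + 1 => {x | 2 ^ j < ‖x‖ ∧ ‖x‖ ≤ 2 ^ (j + 1)}

/-- The Agmon-Hörmander norm `sup_j 2^(-j/2) ‖g‖_{L²(D_j)}`. -/
def ahNorm {d : ℕ} (g : EuclideanSpace ℝ (Fin d) → ℂ) : ℝ≥0∞ :=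
  ⨆ j : ℕ, (2 : ℝ≥0∞) ^ (-(j : ℝ) / 2) * eLpNorm g 2 (volume.restrict (shell d j))

/-- The weight `m_λ(ξ) = |λ - |ξ|²|`. -/
def mWeight {d : ℕ} (lam : ℝ) (ξ : EuclideanSpace ℝ (Fin d)) : ℝ := |lam - ‖ξ‖ ^ 2|

/-- `‖m_λ^(1/2) g‖_{L²}`. -/
def mNorm {d : ℕ} (lam : ℝ) (g : EuclideanSpace ℝ (Fin d) → ℂ) : ℝ≥0∞ :=
  eLpNorm (fun ξ => (Real.sqrt (mWeight lam ξ) : ℂ) * g ξ) 2 volume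

/-- The critical scale: the integer `k` with `2^(k-1) < λ^(1/2) ≤ 2^k`. -/
def critScale (lam : ℝ) : ℤ := Int.clog 2 (Real.sqrt lam)

theorem critScale_spec {lam : ℝ} (h : 0 < lam) :
    (2 : ℝ) ^ (critScale lam - 1) < Real.sqrt lam ∧
      Real.sqrt lam ≤ (2 : ℝ) ^ critScale lam := by
  constructor
  · exact_mod_cast Int.zpow_pred_clog_lt_self (b := 2) (by norm_num) (Real.sqrt_pos.2 h)
  · exact_mod_cast Int.self_le_zpow_clog (b := 2) (by norm_num) (Real.sqrt lam)

/-- The norm of `Y_λ^*` (with value `∞` outside `Y_λ^*`). The set `I` of critical indices is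
`{k_λ - 2, k_λ - 1, k_λ, k_λ + 1}`, and `P_{<I} = P_{≤ k_λ - 3}`. -/
def yStarNorm {d : ℕ} (φ : 𝓢(EuclideanSpace ℝ (Fin d), ℂ)) (lam : ℝ)
    (u : 𝓢'(EuclideanSpace ℝ (Fin d), ℂ)) : ℝ≥0∞ :=
  (distNorm (mNorm lam) (hatD d (lpLow φ (critScale lam - 3) u)) ^ 2
    + ∑ k ∈ Finset.Icc (critScale lam - 2) (critScale lam + 1),
        ENNReal.ofReal (Real.sqrt lam) * distNorm ahNorm (lpProj φ k u) ^ 2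
    + ∑' k : {k : ℤ // critScale lam + 1 < k},
        distNorm (mNorm lam) (hatD d (lpProj φ k u)) ^ 2) ^ (1 / 2 : ℝ)

/-- The space `Y_λ^*`, a set of tempered distributions. -/
def YStar {d : ℕ} (φ : 𝓢(EuclideanSpace ℝ (Fin d), ℂ)) (lam : ℝ) :
    Set 𝓢'(EuclideanSpace ℝ (Fin d), ℂ) :=
  {u | yStarNorm φ lam u < ∞}

/-- The homogeneous Besov semi-norm `∑_{l ∈ ℤ} 2^(l/2) ‖P_l u‖_{L²}`. -/
def besovSeminorm {d : ℕ} (φ : 𝓢(EuclideanSpace ℝ (Fin d), ℂ))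
    (u : 𝓢'(EuclideanSpace ℝ (Fin d), ℂ)) : ℝ≥0∞ :=
  ∑' l : ℤ, (2 : ℝ≥0∞) ^ ((l : ℝ) / 2) *
    distNorm (fun g => eLpNorm g 2 volume) (lpProj φ l u)

/-! ### Lipschitz hypersurfaces -/

/-- `Γ` is a hypersurface of `ℝᵈ` locally described by graphs of Lipschitz functions: near each of
its points it is the graph `{y + h(y)ν : y ∈ ν^⊥}` of a Lipschitz function `h` over the hyperplane
orthogonal to some unit vector `ν`. -/
def IsLipschitzHypersurface {d : ℕ} (Γ : Set (EuclideanSpace ℝ (Fin d))) : Prop :=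
  ∀ p ∈ Γ, ∃ U : Set (EuclideanSpace ℝ (Fin d)), IsOpen U ∧ p ∈ U ∧
    ∃ ν : EuclideanSpace ℝ (Fin d), ‖ν‖ = 1 ∧
      ∃ (K : ℝ≥0) (h : (Submodule.span ℝ {ν})ᗮ → ℝ), LipschitzWith K h ∧
        Γ ∩ U = (Set.range fun y : (Submodule.span ℝ {ν})ᗮ =>
          (y : EuclideanSpace ℝ (Fin d)) + h y • ν) ∩ U

/-- The surface measure of a Lipschitz hypersurface `Γ` of `ℝᵈ`: the `(d-1)`-dimensional Hausdorff
measure, normalised to agree with Lebesgue measure on hyperplanes, restricted to `Γ`. -/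
def surfaceMeasure {d : ℕ} (Γ : Set (EuclideanSpace ℝ (Fin d))) :
    Measure (EuclideanSpace ℝ (Fin d)) :=
  (Measure.euclideanHausdorffMeasure (d - 1)).restrict Γ

end

/-! Each Littlewood-Paley piece of `u` is worth a factor of at least `2^(-k/2)` in a local norm. Off
the critical scales the symbol lives where `m_λ ≥ (2^k/4)^2` (with `k = k_λ` for the low part), so
Plancherel gives an `L²` bound of size `2^(-k)` (`distNorm_lpLow_le`, `distNorm_lpProj_le`). At the
four critical scales only the Agmon-Hörmander norm is available; it dominates the `L²` norm with
weight `(1+|x|)^(-2)` (`lintegral_weight_le_ahNorm`), and the factor `λ^(1/2) ≈ 2^(k_λ)` in the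
definition of the norm supplies the gain.

Trace inequality. A function `F` with frequencies `≲ 2^n`, `n ≥ 0`, is its own convolution with a
kernel of mass `O(1)` at scale `2^(-n)`. A Schur-type argument needs the integral of that kernel
over `Γ`: its height is `2^(nd)`, and a ball of radius `2^(-n)` meets `Γ` in measure
`O(2^(-n(d-1)))`, so the loss is `2^n` in the squared norm. Since `Γ` is bounded, the kernel's tails
also produce the weight `(1+|y|)^(-2)` (`exists_lintegral_lpLowSchwartz_le`). Thus critical pieces
are `O(1)` on `Γ` and high pieces are `O(2^(-k/2))`, which can be summed; Fatou's lemma recovers `f`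
from its partial sums.

Besov estimate. Multiplication by `χ` moves frequencies by at most one, and `χ` decays fast enough
to turn both local norms into `L²` norms (`exists_distNorm_smulLeftCLM_le`). For `l` above `k_λ + 4`
only five neighbouring pieces of `u` enter `P_l(χu)`, giving `2^(l/2) 2^(-l)`. For smaller `l`
everything comes from frequencies up to about `2^(k_λ)`, of local size `2^(-k_λ/2)`, giving
`2^((l-k_λ)/2)`. Both tails are geometric, centred at `k_λ`. -/

/-! ### Tempered distributions given by functions. -/

theorem Represents.locallyIntegrable {d : ℕ} {T : 𝓢'(EuclideanSpace ℝ (Fin d), ℂ)}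
    {g : EuclideanSpace ℝ (Fin d) → ℂ} (h : Represents T g) : LocallyIntegrable g volume := by
  intro x
  let b : ContDiffBump x := ⟨1, 2, by norm_num, by norm_num⟩
  have hb : HasCompactSupport (fun y => ((b y : ℝ) : ℂ)) :=
    b.hasCompactSupport.comp_left Complex.ofReal_zero
  have hs : ContDiff ℝ ((⊤ : ℕ∞) : WithTop ℕ∞) (fun y => ((b y : ℝ) : ℂ)) :=
    Complex.ofRealCLM.contDiff.comp b.contDiff
  refine ⟨Metric.closedBall x 1, Metric.closedBall_mem_nhds x one_pos, ?_⟩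
  refine ((h.2 (hb.toSchwartzMap hs)).1.integrableOn).congr_fun (fun y hy => ?_)
    Metric.isClosed_closedBall.measurableSet
  have : b y = 1 := b.one_of_mem_closedBall hy
  change ((b y : ℝ) : ℂ) * g y = g y
  simp [this]

theorem Represents.integral_contDiff {d : ℕ} {T : 𝓢'(EuclideanSpace ℝ (Fin d), ℂ)}
    {g : EuclideanSpace ℝ (Fin d) → ℂ} (h : Represents T g)
    {b : EuclideanSpace ℝ (Fin d) → ℝ} (hb : ContDiff ℝ ((⊤ : ℕ∞) : WithTop ℕ∞) b) (hc : HasCompactSupport b) :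
    ∃ θ : 𝓢(EuclideanSpace ℝ (Fin d), ℂ), (∀ x, θ x = (b x : ℂ)) ∧ ∫ x, b x • g x = T θ := by
  have hc' : HasCompactSupport (fun y => ((b y : ℝ) : ℂ)) := hc.comp_left Complex.ofReal_zero
  have hs : ContDiff ℝ ((⊤ : ℕ∞) : WithTop ℕ∞) (fun y => ((b y : ℝ) : ℂ)) := Complex.ofRealCLM.contDiff.comp hb
  refine ⟨hc'.toSchwartzMap hs, fun _ => rfl, ?_⟩
  rw [(h.2 _).2]
  rfl

/-- Smooth compactly supported test functions separate locally integrable functions. This makes the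
infimum in `distNorm` the value at any single representative, for every functional that respects
null sets. -/
theorem Represents.ae_eq {d : ℕ} {T : 𝓢'(EuclideanSpace ℝ (Fin d), ℂ)}
    {g g' : EuclideanSpace ℝ (Fin d) → ℂ} (h : Represents T g) (h' : Represents T g') :
    g =ᵐ[volume] g' := by
  refine ae_eq_of_integral_contDiff_smul_eq h.locallyIntegrable h'.locallyIntegrable
    fun b hb hc => ?_
  obtain ⟨θ, hθ, e⟩ := h.integral_contDiff hb hc
  obtain ⟨θ', hθ', e'⟩ := h'.integral_contDiff hb hc
  have : θ = θ' := by ext x; rw [hθ, hθ']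
  rw [e, e', this]

/-- A distribution annihilated by the test functions supported in an open set vanishes there. -/
theorem Represents.ae_eq_zero_of_isOpen {d : ℕ} {T : 𝓢'(EuclideanSpace ℝ (Fin d), ℂ)}
    {g : EuclideanSpace ℝ (Fin d) → ℂ} (h : Represents T g)
    {V : Set (EuclideanSpace ℝ (Fin d))} (hV : IsOpen V)
    (hT : ∀ θ : 𝓢(EuclideanSpace ℝ (Fin d), ℂ), (∀ x ∉ V, θ x = 0) → T θ = 0) :
    ∀ᵐ x, x ∈ V → g x = 0 := by
  refine hV.ae_eq_zero_of_integral_contDiff_smul_eq_zero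
    (h.locallyIntegrable.locallyIntegrableOn V) fun b hb hc hs => ?_
  obtain ⟨θ, hθ, e⟩ := h.integral_contDiff hb hc
  rw [e]
  refine hT θ fun x hx => ?_
  rw [hθ, image_eq_zero_of_notMem_tsupport fun hx' => hx (hs hx'), Complex.ofReal_zero]

theorem represents_toTemperedDistributionCLM {d : ℕ} (f : 𝓢(EuclideanSpace ℝ (Fin d), ℂ)) :
    Represents (SchwartzMap.toTemperedDistributionCLM (EuclideanSpace ℝ (Fin d)) ℂ volume f) f := by
  refine ⟨f.continuous.aestronglyMeasurable, fun θ => ⟨?_, ?_⟩⟩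
  · exact (SchwartzMap.smulLeftCLM ℂ θ f).integrable.congr (.of_forall fun x => by
      simp [SchwartzMap.smulLeftCLM_apply_apply θ.hasTemperateGrowth])
  · simp [SchwartzMap.toTemperedDistributionCLM_apply_apply]

theorem represents_of_memLp {d : ℕ} {g : EuclideanSpace ℝ (Fin d) → ℂ} (hg : MemLp g 2 volume) :
    Represents (Lp.toTemperedDistribution (hg.toLp g)) g := by
  refine ⟨hg.1, fun θ => ⟨?_, ?_⟩⟩
  · exact (θ.memLp 2 volume).integrable_mul hg
  · rw [Lp.toTemperedDistribution_apply]
    refine integral_congr_ae ?_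
    filter_upwards [hg.coeFn_toLp] with x hx
    rw [hx, smul_eq_mul]

theorem represents_Lp {d : ℕ} (g : Lp ℂ 2 (volume : Measure (EuclideanSpace ℝ (Fin d)))) :
    Represents (Lp.toTemperedDistribution g) g := by
  have := represents_of_memLp (Lp.memLp g)
  rwa [Lp.toLp_coeFn] at this

theorem Represents.unique {d : ℕ} {T T' : 𝓢'(EuclideanSpace ℝ (Fin d), ℂ)}
    {g g' : EuclideanSpace ℝ (Fin d) → ℂ} (h : Represents T g) (h' : Represents T' g')
    (e : g =ᵐ[volume] g') : T = T' := by
  ext θ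
  rw [(h.2 θ).2, (h'.2 θ).2]
  refine integral_congr_ae ?_
  filter_upwards [e] with x hx
  rw [hx]

theorem Represents.eq_toTemperedDistribution {d : ℕ} {T : 𝓢'(EuclideanSpace ℝ (Fin d), ℂ)}
    {g : EuclideanSpace ℝ (Fin d) → ℂ} (h : Represents T g) (hg : MemLp g 2 volume) :
    T = Lp.toTemperedDistribution (hg.toLp g) :=
  h.unique (represents_of_memLp hg) .rfl

theorem Represents.smulLeftCLM {d : ℕ} {T : 𝓢'(EuclideanSpace ℝ (Fin d), ℂ)}
    {g a : EuclideanSpace ℝ (Fin d) → ℂ} (h : Represents T g) (ha : a.HasTemperateGrowth) :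
    Represents (TemperedDistribution.smulLeftCLM ℂ a T) (fun x => a x * g x) := by
  refine ⟨ha.1.continuous.aestronglyMeasurable.mul h.1, fun θ => ?_⟩
  have h2 := h.2 (SchwartzMap.smulLeftCLM ℂ a θ)
  have e : ∀ x, θ x * (a x * g x) = SchwartzMap.smulLeftCLM ℂ a θ x * g x := fun x => by
    rw [SchwartzMap.smulLeftCLM_apply_apply ha, smul_eq_mul]; ring
  simp only [e]
  exact ⟨h2.1, by rw [TemperedDistribution.smulLeftCLM_apply_apply, h2.2]⟩

theorem Represents.add {d : ℕ} {T T' : 𝓢'(EuclideanSpace ℝ (Fin d), ℂ)}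
    {g g' : EuclideanSpace ℝ (Fin d) → ℂ} (h : Represents T g) (h' : Represents T' g') :
    Represents (T + T') (fun x => g x + g' x) := by
  refine ⟨h.1.add h'.1, fun θ => ?_⟩
  simp only [mul_add]
  refine ⟨(h.2 θ).1.add (h'.2 θ).1, ?_⟩
  rw [integral_add (h.2 θ).1 (h'.2 θ).1, ← (h.2 θ).2, ← (h'.2 θ).2]
  rfl

theorem distNorm_le {d : ℕ} {N : (EuclideanSpace ℝ (Fin d) → ℂ) → ℝ≥0∞}
    {T : 𝓢'(EuclideanSpace ℝ (Fin d), ℂ)} {g : EuclideanSpace ℝ (Fin d) → ℂ}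
    (h : Represents T g) : distNorm N T ≤ N g :=
  iInf₂_le g h

/-- To bound a quantity by `distNorm N T` it suffices to treat functions representing `T`. -/
theorem le_mul_distNorm {d : ℕ} {N : (EuclideanSpace ℝ (Fin d) → ℂ) → ℝ≥0∞}
    {T : 𝓢'(EuclideanSpace ℝ (Fin d), ℂ)} {A C : ℝ≥0∞} (hC : C ≠ 0) (hC' : C ≠ ∞)
    (h : ∀ g, Represents T g → A ≤ C * N g) : A ≤ C * distNorm N T := by
  unfold distNorm
  simp only [ENNReal.mul_iInf_of_ne hC hC']
  exact le_iInf₂ fun g hg => h g hg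

theorem eLpNorm_le_distNorm {d : ℕ} {T : 𝓢'(EuclideanSpace ℝ (Fin d), ℂ)}
    {g : EuclideanSpace ℝ (Fin d) → ℂ} (h : Represents T g) :
    eLpNorm g 2 volume ≤ distNorm (fun g => eLpNorm g 2 volume) T :=
  le_iInf₂ fun _ hg' => (eLpNorm_congr_ae (h.ae_eq hg')).le

theorem ahNorm_congr_ae {d : ℕ} {g g' : EuclideanSpace ℝ (Fin d) → ℂ} (h : g =ᵐ[volume] g') :
    ahNorm g = ahNorm g' := by
  unfold ahNorm
  exact iSup_congr fun j => by rw [eLpNorm_congr_ae (ae_restrict_of_ae h)]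

theorem distNorm_add_le {d : ℕ} (T T' : 𝓢'(EuclideanSpace ℝ (Fin d), ℂ)) :
    distNorm (fun g => eLpNorm g 2 volume) (T + T') ≤
      distNorm (fun g => eLpNorm g 2 volume) T + distNorm (fun g => eLpNorm g 2 volume) T' := by
  by_cases hT : ∃ g, Represents T g
  · by_cases hT' : ∃ g, Represents T' g
    · obtain ⟨g, hg⟩ := hT
      obtain ⟨g', hg'⟩ := hT'
      calc _ ≤ eLpNorm (fun x => g x + g' x) 2 volume := distNorm_le (hg.add hg')
        _ ≤ eLpNorm g 2 volume + eLpNorm g' 2 volume := eLpNorm_add_le hg.1 hg'.1 (by norm_num)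
        _ ≤ _ := add_le_add (eLpNorm_le_distNorm hg) (eLpNorm_le_distNorm hg')
    · rw [show distNorm (fun g => eLpNorm g 2 volume) T' = ∞ by
        simp only [distNorm, iInf_eq_top]; exact fun g hg => absurd ⟨g, hg⟩ hT']
      simp
  · rw [show distNorm (fun g => eLpNorm g 2 volume) T = ∞ by
        simp only [distNorm, iInf_eq_top]; exact fun g hg => absurd ⟨g, hg⟩ hT]
    simp

/-! ### Plancherel and bounded multipliers, in both Fourier normalisations. -/

theorem hasTemperateGrowth_comp_two_pi {d : ℕ} {g : EuclideanSpace ℝ (Fin d) → ℂ}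
    (hg : g.HasTemperateGrowth) :
    (fun η : EuclideanSpace ℝ (Fin d) => g ((2 * Real.pi) • η)).HasTemperateGrowth := by
  fun_prop

/-- Plancherel's theorem for a tempered distribution whose Mathlib Fourier transform is an `L²`
function. -/
theorem distNorm_le_of_represents_fourier {d : ℕ} {T : 𝓢'(EuclideanSpace ℝ (Fin d), ℂ)}
    {g : EuclideanSpace ℝ (Fin d) → ℂ} (h : Represents (𝓕 T) g) :
    distNorm (fun g => eLpNorm g 2 volume) T ≤ eLpNorm g 2 volume := by
  by_cases hg : eLpNorm g 2 volume = ∞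
  · rw [hg]; exact le_top
  have hm : MemLp g 2 volume := ⟨h.1, lt_top_iff_ne_top.2 hg⟩
  have hT : T = Lp.toTemperedDistribution (𝓕⁻ (hm.toLp g)) := by
    rw [← Lp.fourierInv_toTemperedDistribution_eq, ← h.eq_toTemperedDistribution hm,
      FourierTransform.fourierInv_fourier_eq]
  have hn : ‖𝓕⁻ (hm.toLp g)‖ = ‖hm.toLp g‖ := by
    rw [← Lp.norm_fourier_eq, FourierTransform.fourier_fourierInv_eq]
  have hr := represents_Lp (𝓕⁻ (hm.toLp g))
  rw [← hT] at hr
  refine (distNorm_le hr).trans (le_of_eq ?_)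
  rw [← Lp.enorm_def, ← ofReal_norm, hn, ofReal_norm, Lp.enorm_def]
  exact eLpNorm_congr_ae hm.coeFn_toLp

/-- A Fourier multiplier with a bounded symbol is bounded on `L²`. -/
theorem distNorm_multD_le {d : ℕ} {g : EuclideanSpace ℝ (Fin d) → ℂ} (hg : g.HasTemperateGrowth)
    {B : ℝ} (hB : 0 < B) (hgB : ∀ ξ, ‖g ξ‖ ≤ B) (T : 𝓢'(EuclideanSpace ℝ (Fin d), ℂ)) :
    distNorm (fun g => eLpNorm g 2 volume) (multD g T) ≤
      ENNReal.ofReal B * distNorm (fun g => eLpNorm g 2 volume) T := by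
  refine le_mul_distNorm (by simpa using hB) ENNReal.ofReal_ne_top fun w hw => ?_
  by_cases hwt : eLpNorm w 2 volume = ∞
  · rw [hwt, ENNReal.mul_top (by simpa using hB)]; exact le_top
  have hm : MemLp w 2 volume := ⟨hw.1, lt_top_iff_ne_top.2 hwt⟩
  have h1 : Represents (𝓕 T) (𝓕 (hm.toLp w) : Lp ℂ 2 volume) := by
    rw [hw.eq_toTemperedDistribution hm, Lp.fourier_toTemperedDistribution_eq]
    exact represents_Lp _
  have h2 := h1.smulLeftCLM (hasTemperateGrowth_comp_two_pi hg)
  have h3 : 𝓕 (multD g T) = TemperedDistribution.smulLeftCLM ℂ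
      (fun η => g ((2 * Real.pi) • η)) (𝓕 T) := by
    rw [multD, TemperedDistribution.fourierMultiplierCLM_apply,
      FourierTransform.fourier_fourierInv_eq]
  rw [← h3] at h2
  refine (distNorm_le_of_represents_fourier h2).trans ?_
  calc _ ≤ ENNReal.ofReal B * eLpNorm (𝓕 (hm.toLp w) : Lp ℂ 2 volume) 2 volume :=
        eLpNorm_le_mul_eLpNorm_of_ae_le_mul (.of_forall fun x => by
          rw [norm_mul]; exact mul_le_mul_of_nonneg_right (hgB _) (norm_nonneg _)) 2
    _ = _ := by
        rw [← Lp.enorm_def, ← ofReal_norm, Lp.norm_fourier_eq, ofReal_norm, Lp.enorm_def,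
          eLpNorm_congr_ae hm.coeFn_toLp]

theorem eLpNorm_comp_smul {d : ℕ} {c : ℝ} (hc : 0 < c) {g : EuclideanSpace ℝ (Fin d) → ℂ}
    (hg : AEStronglyMeasurable g volume) :
    AEStronglyMeasurable (fun x => g (c • x)) volume ∧
    eLpNorm (fun x => g (c • x)) 2 volume =
      ENNReal.ofReal ((c ^ d)⁻¹) ^ (1 / 2 : ℝ) * eLpNorm g 2 volume := by
  have hmap : Measure.map (fun x : EuclideanSpace ℝ (Fin d) => c • x) volume =
      ENNReal.ofReal ((c ^ d)⁻¹) • volume := by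
    have := Measure.map_addHaar_smul (volume : Measure (EuclideanSpace ℝ (Fin d))) hc.ne'
    rw [finrank_euclideanSpace_fin, abs_of_pos (by positivity)] at this
    exact this
  have hg' : AEStronglyMeasurable g
      (Measure.map (fun x : EuclideanSpace ℝ (Fin d) => c • x) volume) := by
    rw [hmap]; exact hg.smul_measure _
  refine ⟨hg'.comp_measurable (measurable_const_smul c), ?_⟩
  have := eLpNorm_map_measure (p := 2) hg' (measurable_const_smul c).aemeasurable
  rw [hmap, eLpNorm_smul_measure_of_ne_top (by norm_num)] at this
  change eLpNorm (g ∘ fun x => c • x) 2 volume = _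
  rw [← this]
  simp

/-- If `T̂` is a function, so is the Fourier transform of `T` in Mathlib's normalisation. -/
theorem Represents.fourier_of_hatD {d : ℕ} {T : 𝓢'(EuclideanSpace ℝ (Fin d), ℂ)}
    {g : EuclideanSpace ℝ (Fin d) → ℂ} (h : Represents (hatD d T) g) :
    Represents (𝓕 T) (fun y => (((2 * Real.pi) ^ (-(d : ℝ) / 2) : ℝ) : ℂ)⁻¹ *
      g ((2 * Real.pi) • y)) := by
  have hp : (0 : ℝ) < 2 * Real.pi := Real.two_pi_pos
  refine ⟨(eLpNorm_comp_smul hp h.1).1.const_mul _, fun θ => ?_⟩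
  let θ' : 𝓢(EuclideanSpace ℝ (Fin d), ℂ) := SchwartzMap.compCLMOfContinuousLinearEquiv ℂ
    (dilation d (2 * Real.pi)⁻¹ (inv_ne_zero hp.ne')) θ
  have hθ' : ∀ x, θ' x = θ ((2 * Real.pi)⁻¹ • x) := fun _ => rfl
  have hθ : SchwartzMap.compCLMOfContinuousLinearEquiv ℂ (dilation d (2 * Real.pi) hp.ne') θ' = θ := by
    ext x
    change θ ((2 * Real.pi)⁻¹ • (2 * Real.pi) • x) = θ x
    rw [inv_smul_smul₀ hp.ne']
  have h1 := h.2 θ'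
  rw [hatD_apply, hatS_eq_fourier_dilation, hθ, map_smul] at h1
  have e : ∀ y, θ y * ((((2 * Real.pi) ^ (-(d : ℝ) / 2) : ℝ) : ℂ)⁻¹ * g ((2 * Real.pi) • y)) =
      (((2 * Real.pi) ^ (-(d : ℝ) / 2) : ℝ) : ℂ)⁻¹ *
        (fun x => θ' x * g x) ((2 * Real.pi) • y) := fun y => by
    simp only [hθ', inv_smul_smul₀ hp.ne']; ring
  simp only [e]
  refine ⟨(h1.1.comp_smul hp.ne').const_mul _, ?_⟩
  rw [integral_const_mul, Measure.integral_comp_smul volume (fun x => θ' x * g x), ← h1.2, TemperedDistribution.fourier_apply,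
    finrank_euclideanSpace_fin, abs_of_pos (by positivity), Complex.real_smul, smul_eq_mul]
  have h2 : (((2 * Real.pi) ^ (-(d : ℝ) / 2) : ℝ) : ℂ) ≠ 0 :=
    Complex.ofReal_ne_zero.2 (Real.rpow_pos_of_pos hp _).ne'
  have h3 : (((2 * Real.pi) ^ d : ℝ) : ℂ) ≠ 0 :=
    Complex.ofReal_ne_zero.2 (pow_pos hp _).ne'
  rw [Complex.ofReal_inv]
  generalize (((2 * Real.pi) ^ (-(d : ℝ) / 2) : ℝ) : ℂ) = a at h2 ⊢
  generalize (((2 * Real.pi) ^ d : ℝ) : ℂ) = b at h3 ⊢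
  field_simp

/-- Plancherel's theorem in the unitary normalisation. -/
theorem distNorm_le_of_represents_hatD {d : ℕ} {T : 𝓢'(EuclideanSpace ℝ (Fin d), ℂ)}
    {g : EuclideanSpace ℝ (Fin d) → ℂ} (h : Represents (hatD d T) g) :
    distNorm (fun g => eLpNorm g 2 volume) T ≤ eLpNorm g 2 volume := by
  have hp : (0 : ℝ) < 2 * Real.pi := Real.two_pi_pos
  refine (distNorm_le_of_represents_fourier h.fourier_of_hatD).trans (le_of_eq ?_)
  have := eLpNorm_const_smul ((((2 * Real.pi) ^ (-(d : ℝ) / 2) : ℝ) : ℂ)⁻¹)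
    (fun y => g ((2 * Real.pi) • y)) 2 volume
  change eLpNorm (((((2 * Real.pi) ^ (-(d : ℝ) / 2) : ℝ) : ℂ)⁻¹) •
    (fun y => g ((2 * Real.pi) • y))) 2 volume = _
  rw [this, (eLpNorm_comp_smul hp h.1).2, ← mul_assoc]
  have h0 : (0 : ℝ) < (2 * Real.pi) ^ (-(d : ℝ) / 2) := Real.rpow_pos_of_pos hp _
  have h1 : ENNReal.ofReal (((2 * Real.pi) ^ d)⁻¹) ^ (1 / 2 : ℝ) =
      ENNReal.ofReal ((2 * Real.pi) ^ (-(d : ℝ) / 2)) := by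
    rw [ENNReal.ofReal_rpow_of_pos (by positivity), ← Real.rpow_natCast, ← Real.rpow_neg hp.le,
      ← Real.rpow_mul hp.le]
    congr 2; ring
  rw [h1, ← ofReal_norm, ← ENNReal.ofReal_mul (norm_nonneg _), norm_inv, Complex.norm_real,
    Real.norm_of_nonneg h0.le, inv_mul_cancel₀ h0.ne', ENNReal.ofReal_one, one_mul]

/-! ### Supports and bounds of the Littlewood-Paley symbols. -/

theorem IsLPBase.eq_zero {d : ℕ} {φ : 𝓢(EuclideanSpace ℝ (Fin d), ℂ)} (hφ : IsLPBase φ)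
    {ξ : EuclideanSpace ℝ (Fin d)} (h : 2 < ‖ξ‖) : φ ξ = 0 := by
  refine image_eq_zero_of_notMem_tsupport fun hx => ?_
  have := hφ.1 hx
  rw [mem_closedBall_zero_iff] at this
  exact absurd h this.not_gt

theorem lowSymbol_eq_zero {d : ℕ} {φ : 𝓢(EuclideanSpace ℝ (Fin d), ℂ)} (hφ : IsLPBase φ) {k : ℤ}
    {ξ : EuclideanSpace ℝ (Fin d)} (h : 2 * (2 : ℝ) ^ k < ‖ξ‖) : lowSymbol φ k ξ = 0 := by
  refine hφ.eq_zero ?_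
  have h2 : (0 : ℝ) < 2 ^ k := by positivity
  rw [norm_smul, norm_inv, Real.norm_of_nonneg h2.le, inv_mul_eq_div, lt_div_iff₀ h2]
  exact h

theorem lowSymbol_eq_one {d : ℕ} {φ : 𝓢(EuclideanSpace ℝ (Fin d), ℂ)} (hφ : IsLPBase φ) {k : ℤ}
    {ξ : EuclideanSpace ℝ (Fin d)} (h : ‖ξ‖ ≤ (2 : ℝ) ^ k) : lowSymbol φ k ξ = 1 := by
  refine hφ.2 _ ?_
  have h2 : (0 : ℝ) < 2 ^ k := by positivity
  rw [norm_smul, norm_inv, Real.norm_of_nonneg h2.le, inv_mul_eq_div, div_le_one h2]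
  exact h

theorem annSymbol_eq_sub {d : ℕ} (φ : 𝓢(EuclideanSpace ℝ (Fin d), ℂ)) (k : ℤ) :
    annSymbol φ k = lowSymbol φ k - lowSymbol φ (k - 1) := by
  ext ξ
  simp only [annSymbol, lowSymbol, Pi.sub_apply, smul_smul]
  congr 3
  rw [zpow_sub_one₀ two_ne_zero, mul_inv, inv_inv, mul_comm]

theorem annSymbol_eq_zero_of_lt {d : ℕ} {φ : 𝓢(EuclideanSpace ℝ (Fin d), ℂ)} (hφ : IsLPBase φ)
    {k : ℤ} {ξ : EuclideanSpace ℝ (Fin d)} (h : 2 * (2 : ℝ) ^ k < ‖ξ‖) : annSymbol φ k ξ = 0 := by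
  have h2 : (0 : ℝ) < 2 ^ k := by positivity
  rw [annSymbol_eq_sub, Pi.sub_apply, lowSymbol_eq_zero hφ h, lowSymbol_eq_zero hφ, sub_zero]
  rw [zpow_sub_one₀ two_ne_zero]
  linarith

theorem annSymbol_eq_zero_of_le {d : ℕ} {φ : 𝓢(EuclideanSpace ℝ (Fin d), ℂ)} (hφ : IsLPBase φ)
    {k : ℤ} {ξ : EuclideanSpace ℝ (Fin d)} (h : ‖ξ‖ ≤ (2 : ℝ) ^ k / 2) : annSymbol φ k ξ = 0 := by
  have h2 : (0 : ℝ) < 2 ^ k := by positivity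
  rw [annSymbol_eq_sub, Pi.sub_apply, lowSymbol_eq_one hφ (by linarith), lowSymbol_eq_one hφ,
    sub_self]
  rw [zpow_sub_one₀ two_ne_zero]
  linarith

theorem exists_norm_symbol_le {d : ℕ} (φ : 𝓢(EuclideanSpace ℝ (Fin d), ℂ)) :
    ∃ B : ℝ, 0 < B ∧ (∀ k ξ, ‖lowSymbol φ k ξ‖ ≤ B) ∧ ∀ k ξ, ‖annSymbol φ k ξ‖ ≤ B := by
  obtain ⟨C, hC⟩ := φ.decay 0 0
  have h : ∀ ξ, ‖φ ξ‖ ≤ C := fun ξ => by simpa using hC.2 ξ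
  refine ⟨2 * C, by linarith [hC.1], fun k ξ => (h _).trans (by linarith [hC.1]), fun k ξ => ?_⟩
  refine (norm_sub_le _ _).trans ?_
  linarith [h (((2 : ℝ) ^ k)⁻¹ • ξ), h ((2 : ℝ) • ((2 : ℝ) ^ k)⁻¹ • ξ)]

theorem multD_sub {d : ℕ} {g₁ g₂ : EuclideanSpace ℝ (Fin d) → ℂ} (h₁ : g₁.HasTemperateGrowth)
    (h₂ : g₂.HasTemperateGrowth) (u : 𝓢'(EuclideanSpace ℝ (Fin d), ℂ)) :
    multD (g₁ - g₂) u = multD g₁ u - multD g₂ u := by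
  have h : TemperedDistribution.smulLeftCLM ℂ (fun η => (g₁ - g₂) ((2 * Real.pi) • η)) (𝓕 u) =
      TemperedDistribution.smulLeftCLM ℂ (fun η => g₁ ((2 * Real.pi) • η)) (𝓕 u) -
        TemperedDistribution.smulLeftCLM ℂ (fun η => g₂ ((2 * Real.pi) • η)) (𝓕 u) :=
    congrArg (· (𝓕 u)) (TemperedDistribution.smulLeftCLM_sub (F := ℂ)
      (hasTemperateGrowth_comp_two_pi h₁) (hasTemperateGrowth_comp_two_pi h₂))
  simp only [multD, TemperedDistribution.fourierMultiplierCLM_apply, h]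
  exact map_sub (FourierTransform.fourierInvCLM ℂ 𝓢'(EuclideanSpace ℝ (Fin d), ℂ)) _ _

theorem lpProj_eq_sub {d : ℕ} (φ : 𝓢(EuclideanSpace ℝ (Fin d), ℂ)) (k : ℤ)
    (u : 𝓢'(EuclideanSpace ℝ (Fin d), ℂ)) : lpProj φ k u = lpLow φ k u - lpLow φ (k - 1) u := by
  rw [lpProj, annSymbol_eq_sub, multD_sub (lowSymbol_hasTemperateGrowth φ k)
    (lowSymbol_hasTemperateGrowth φ (k - 1))]
  rfl

/-! ### `L²` bounds away from the critical sphere. -/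

/-- On the support of a symbol where the weight is bounded below, the weighted norm controls the
`L²` norm. -/
theorem distNorm_multD_le_mNorm {d : ℕ} {g : EuclideanSpace ℝ (Fin d) → ℂ}
    (hg : g.HasTemperateGrowth) {V : Set (EuclideanSpace ℝ (Fin d))} (hV : IsOpen V)
    (hgV : ∀ ξ ∈ V, g ξ = 0) {lam c : ℝ} (hc : 0 < c) (hm : ∀ ξ ∉ V, c ^ 2 ≤ mWeight lam ξ)
    (u : 𝓢'(EuclideanSpace ℝ (Fin d), ℂ)) :
    distNorm (fun g => eLpNorm g 2 volume) (multD g u) ≤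
      ENNReal.ofReal c⁻¹ * distNorm (mNorm lam) (hatD d (multD g u)) := by
  refine le_mul_distNorm (by simpa using hc) ENNReal.ofReal_ne_top fun G hG => ?_
  refine (distNorm_le_of_represents_hatD hG).trans ?_
  -- `û` need not be a function, so the vanishing of `G` on `V` cannot be read off a product. It is
  -- tested instead: `g` annihilates every test function supported in the open set `V`.
  have hz : ∀ᵐ x, x ∈ V → G x = 0 := by
    refine hG.ae_eq_zero_of_isOpen hV fun θ hθ => ?_
    rw [hatD_multD hg, TemperedDistribution.smulLeftCLM_apply_apply]
    have : SchwartzMap.smulLeftCLM ℂ g θ = 0 := by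
      ext x
      rw [SchwartzMap.smulLeftCLM_apply_apply hg]
      by_cases hx : x ∈ V
      · simp [hgV x hx]
      · simp [hθ x hx]
    rw [this, map_zero]
  refine eLpNorm_le_mul_eLpNorm_of_ae_le_mul ?_ 2
  filter_upwards [hz] with x hx
  by_cases hxV : x ∈ V
  · simp [hx hxV]
  · have h1 : c ≤ Real.sqrt (mWeight lam x) := Real.le_sqrt_of_sq_le (hm x hxV)
    rw [norm_mul, Complex.norm_real, Real.norm_of_nonneg (Real.sqrt_nonneg _), ← mul_assoc]
    refine le_mul_of_one_le_left (norm_nonneg _) ?_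
    rw [inv_mul_eq_div, one_le_div hc]
    exact h1

/-- With `k = k_λ`, the symbol lives in `|ξ| ≤ 2^k/4` while `√λ > 2^k/2`, so `m_λ ≥ (3/16) 2^(2k) ≥
(2^k/4)^2`. -/
theorem distNorm_lpLow_le {d : ℕ} {φ : 𝓢(EuclideanSpace ℝ (Fin d), ℂ)} (hφ : IsLPBase φ)
    {lam : ℝ} (hl : 0 < lam) (u : 𝓢'(EuclideanSpace ℝ (Fin d), ℂ)) :
    distNorm (fun g => eLpNorm g 2 volume) (lpLow φ (critScale lam - 3) u) ≤
      ENNReal.ofReal (4 * ((2 : ℝ) ^ critScale lam)⁻¹) *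
        distNorm (mNorm lam) (hatD d (lpLow φ (critScale lam - 3) u)) := by
  have hk := (critScale_spec hl).1
  set k := critScale lam
  have h2 : (0 : ℝ) < 2 ^ k := by positivity
  have hs := Real.sq_sqrt hl.le
  rw [zpow_sub_one₀ two_ne_zero] at hk
  have e : (2 : ℝ) ^ (k - 3) = 2 ^ k / 8 := by
    rw [zpow_sub₀ two_ne_zero]; norm_num
  have := distNorm_multD_le_mNorm (lowSymbol_hasTemperateGrowth φ (k - 3))
    (V := {ξ | 2 * (2 : ℝ) ^ (k - 3) < ‖ξ‖}) (isOpen_lt continuous_const continuous_norm)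
    (fun ξ hξ => lowSymbol_eq_zero hφ hξ) (lam := lam) (c := 2 ^ k / 4) (by positivity)
    (fun ξ hξ => ?_) u
  · rwa [inv_div, div_eq_mul_inv] at this
  · simp only [mem_ofPred_eq, not_lt, e] at hξ
    refine le_trans ?_ (le_abs_self _)
    nlinarith [norm_nonneg ξ, Real.sqrt_nonneg lam]

/-- Mirror image of the low-frequency case: now `|ξ| ≥ 2^k/2` and `√λ ≤ 2^k/4`. -/
theorem distNorm_lpProj_le {d : ℕ} {φ : 𝓢(EuclideanSpace ℝ (Fin d), ℂ)} (hφ : IsLPBase φ)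
    {lam : ℝ} (hl : 0 < lam) {k : ℤ} (hk : critScale lam + 1 < k)
    (u : 𝓢'(EuclideanSpace ℝ (Fin d), ℂ)) :
    distNorm (fun g => eLpNorm g 2 volume) (lpProj φ k u) ≤
      ENNReal.ofReal (4 * ((2 : ℝ) ^ k)⁻¹) *
        distNorm (mNorm lam) (hatD d (lpProj φ k u)) := by
  have hs' := (critScale_spec hl).2
  have h2 : (0 : ℝ) < 2 ^ k := by positivity
  have hs := Real.sq_sqrt hl.le
  have hkk : (2 : ℝ) ^ critScale lam ≤ 2 ^ k / 4 := by
    calc (2 : ℝ) ^ critScale lam ≤ 2 ^ (k - 2) := zpow_le_zpow_right₀ (by norm_num) (by omega)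
      _ = _ := by rw [zpow_sub₀ two_ne_zero]; norm_num
  have := distNorm_multD_le_mNorm (annSymbol_hasTemperateGrowth φ k)
    (V := {ξ | ‖ξ‖ < (2 : ℝ) ^ k / 2}) (isOpen_lt continuous_norm continuous_const)
    (fun ξ hξ => annSymbol_eq_zero_of_le hφ (le_of_lt hξ)) (lam := lam) (c := 2 ^ k / 4)
    (by positivity) (fun ξ hξ => ?_) u
  · rwa [inv_div, div_eq_mul_inv] at this
  · simp only [mem_ofPred_eq, not_lt] at hξ
    have : mWeight lam ξ = |‖ξ‖ ^ 2 - lam| := abs_sub_comm _ _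
    rw [this]
    refine le_trans ?_ (le_abs_self _)
    nlinarith [norm_nonneg ξ, Real.sqrt_nonneg lam]

/-! ### The Agmon-Hörmander norm and weighted `L²`. -/

theorem eLpNorm_two_sq {α : Type*} [MeasurableSpace α] (μ : Measure α) (f : α → ℂ) :
    eLpNorm f 2 μ ^ 2 = ∫⁻ x, ‖f x‖ₑ ^ 2 ∂μ := by
  have := eLpNorm_nnreal_pow_eq_lintegral (μ := μ) (f := f) (p := 2) two_ne_zero
  simpa using this

theorem iUnion_shell (d : ℕ) : ⋃ j, shell d j = univ := by
  refine eq_univ_of_forall fun x => mem_iUnion.2 ?_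
  have hex : ∃ j : ℕ, ‖x‖ ≤ 2 ^ j := by
    obtain ⟨n, hn⟩ := pow_unbounded_of_one_lt ‖x‖ (one_lt_two (α := ℝ))
    exact ⟨n, hn.le⟩
  classical
  refine ⟨Nat.find hex, ?_⟩
  have h1 := Nat.find_spec hex
  rcases hj : Nat.find hex with _ | j
  · rw [hj] at h1; simpa [shell] using h1
  · rw [hj] at h1
    exact ⟨not_le.1 (Nat.find_min hex (by omega)), h1⟩

theorem one_add_norm_inv_sq_le_of_mem_shell {d : ℕ} {j : ℕ} {x : EuclideanSpace ℝ (Fin d)}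
    (hx : x ∈ shell d j) : ((1 + ‖x‖) ^ 2)⁻¹ ≤ 4 * ((2 : ℝ) ^ j)⁻¹ ^ 2 := by
  have h2 : (0 : ℝ) < 2 ^ j := by positivity
  have h : (2 : ℝ) ^ j / 2 ≤ 1 + ‖x‖ := by
    rcases j with _ | j
    · norm_num; linarith [norm_nonneg x]
    · have := hx.1
      rw [pow_succ]; linarith
  calc ((1 + ‖x‖) ^ 2)⁻¹ ≤ (((2 : ℝ) ^ j / 2) ^ 2)⁻¹ := by gcongr
    _ = _ := by field_simp; norm_num

/-- A quadratically decaying weight is controlled by the Agmon-Hörmander norm. -/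
theorem lintegral_weight_le_ahNorm {d : ℕ} (g : EuclideanSpace ℝ (Fin d) → ℂ) :
    ∫⁻ x, ENNReal.ofReal (((1 + ‖x‖) ^ 2)⁻¹) * ‖g x‖ₑ ^ 2 ≤ 8 * ahNorm g ^ 2 := by
  -- On the `j`-th shell the weight is at most `4 · 2^(-2j)` and the squared `L²` norm is at most
  -- `2^j` times the squared Agmon-Hörmander norm, which leaves a summable `2^(-j)`.
  have key : ∀ j, ∫⁻ x in shell d j, ENNReal.ofReal (((1 + ‖x‖) ^ 2)⁻¹) * ‖g x‖ₑ ^ 2 ≤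
      4 * ahNorm g ^ 2 * 2⁻¹ ^ j := by
    intro j
    have hm : MeasurableSet (shell d j) := by
      rcases j with _ | j
      · exact measurableSet_le measurable_norm measurable_const
      · exact (measurableSet_lt measurable_const measurable_norm).inter
          (measurableSet_le measurable_norm measurable_const)
    have h1 : (2 : ℝ≥0∞) ^ (-(j : ℝ) / 2) * eLpNorm g 2 (volume.restrict (shell d j)) ≤ ahNorm g :=
      le_iSup (fun j : ℕ => (2 : ℝ≥0∞) ^ (-(j : ℝ) / 2) *
        eLpNorm g 2 (volume.restrict (shell d j))) j
    have h2 : (2⁻¹ : ℝ≥0∞) ^ j * ∫⁻ x in shell d j, ‖g x‖ₑ ^ 2 ≤ ahNorm g ^ 2 := by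
      refine le_trans (le_of_eq ?_) (pow_le_pow_left' h1 2)
      rw [mul_pow, eLpNorm_two_sq]
      congr 1
      rw [← ENNReal.rpow_natCast, ← ENNReal.rpow_natCast, ← ENNReal.rpow_mul, ENNReal.inv_rpow,
        ← ENNReal.rpow_neg]
      congr 1
      push_cast; ring
    calc ∫⁻ x in shell d j, ENNReal.ofReal (((1 + ‖x‖) ^ 2)⁻¹) * ‖g x‖ₑ ^ 2
        ≤ ∫⁻ x in shell d j, (4 * (2⁻¹ ^ j) ^ 2) * ‖g x‖ₑ ^ 2 := by
          refine setLIntegral_mono' hm fun x hx => ?_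
          gcongr
          refine (ENNReal.ofReal_le_ofReal (one_add_norm_inv_sq_le_of_mem_shell hx)).trans ?_
          rw [ENNReal.ofReal_mul (by norm_num), ENNReal.ofReal_pow (by positivity),
            ENNReal.ofReal_inv_of_pos (by positivity), ENNReal.ofReal_pow (by norm_num),
            ENNReal.inv_pow]
          norm_num
      _ = 4 * 2⁻¹ ^ j * (2⁻¹ ^ j * ∫⁻ x in shell d j, ‖g x‖ₑ ^ 2) := by
          rw [lintegral_const_mul' _ _ (by finiteness)]; ring
      _ ≤ 4 * 2⁻¹ ^ j * ahNorm g ^ 2 := by gcongr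
      _ = _ := by ring
  calc _ = ∫⁻ x in ⋃ j, shell d j, ENNReal.ofReal (((1 + ‖x‖) ^ 2)⁻¹) * ‖g x‖ₑ ^ 2 := by
        rw [iUnion_shell, Measure.restrict_univ]
    _ ≤ ∑' j, ∫⁻ x in shell d j, ENNReal.ofReal (((1 + ‖x‖) ^ 2)⁻¹) * ‖g x‖ₑ ^ 2 :=
        lintegral_iUnion_le _ _
    _ ≤ ∑' j, 4 * ahNorm g ^ 2 * 2⁻¹ ^ j := ENNReal.tsum_le_tsum key
    _ = 8 * ahNorm g ^ 2 := by
        rw [ENNReal.tsum_mul_left, ENNReal.tsum_geometric, ENNReal.one_sub_inv_two, inv_inv]; ring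

/-! ### Upper Ahlfors regularity and integrals of decaying kernels. -/

/-- The part of a Lipschitz graph inside a ball of radius `r` has measure `O(r^n)`. -/
theorem exists_measure_lipschitz_graph_inter_closedBall_le {d n : ℕ} (hd : d = n + 1)
    {ν : EuclideanSpace ℝ (Fin d)} (hν : ‖ν‖ = 1)
    {W : Submodule ℝ (EuclideanSpace ℝ (Fin d))} (hW : W = (Submodule.span ℝ {ν})ᗮ) {K : ℝ≥0}
    {h : W → ℝ} (hh : LipschitzWith K h) :
    ∃ A : ℝ≥0, ∀ y : EuclideanSpace ℝ (Fin d), ∀ r : ℝ, 0 < r →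
      (Measure.euclideanHausdorffMeasure n : Measure (EuclideanSpace ℝ (Fin d)))
        ((Set.range fun z : W =>
          (z : EuclideanSpace ℝ (Fin d)) + h z • ν) ∩ Metric.closedBall y r) ≤
        A * ENNReal.ofReal r ^ n := by
  have hfr : Module.finrank ℝ W = n := by
    have h0 : ν ≠ 0 := by rintro rfl; simp at hν
    have h1 := Submodule.finrank_add_finrank_orthogonal (Submodule.span ℝ {ν})
    rw [finrank_span_singleton h0, finrank_euclideanSpace_fin, ← hW] at h1
    omega
  set F : W → EuclideanSpace ℝ (Fin d) := fun z => (z : EuclideanSpace ℝ (Fin d)) + h z • ν with hF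
  have hFL : LipschitzWith (1 + K) F := by
    refine LipschitzWith.add (LipschitzWith.subtype_val _) ?_
    refine LipschitzWith.of_dist_le_mul fun x y => ?_
    rw [dist_eq_norm, ← sub_smul, norm_smul, hν, mul_one]
    exact hh.dist_le_mul x y
  have hvol : (Measure.euclideanHausdorffMeasure n : Measure W) = volume := by
    rw [← hfr]; exact InnerProductSpace.euclideanHausdorffMeasure_eq_volume
  have hfin : (volume : Measure W) (Metric.ball 0 1) ≠ ∞ := measure_ball_lt_top.ne
  refine ⟨(1 + K) ^ n * ((volume : Measure W) (Metric.ball 0 1)).toNNReal, fun y r hr => ?_⟩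
  -- Orthogonal projection onto `W` is a 1-Lipschitz left inverse of `F`, so the base points of the
  -- graph inside the ball lie in a ball of the same radius in `W`.
  have hsub : Set.range F ∩ Metric.closedBall y r ⊆
      F '' Metric.closedBall (W.orthogonalProjectionOnto y) r := by
    rintro _ ⟨⟨z, rfl⟩, hz⟩
    refine ⟨z, ?_, rfl⟩
    have hz' : W.orthogonalProjectionOnto (F z) = z := by
      have h1 : W.orthogonalProjectionOnto ν = 0 := by
        rw [Submodule.orthogonalProjectionOnto_eq_zero_iff, hW,
          Submodule.orthogonal_orthogonal]
        exact Submodule.mem_span_singleton_self ν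
      simp only [hF, map_add, map_smul, h1, smul_zero, add_zero]
      exact Submodule.orthogonalProjectionOnto_mem_subspace_eq_self z
    rw [Metric.mem_closedBall, ← hz']
    exact ((W.lipschitzWith_orthogonalProjectionOnto.dist_le_mul _ _).trans (by simp)).trans
      (Metric.mem_closedBall.1 hz)
  refine (measure_mono hsub).trans ?_
  have h1 : (Measure.euclideanHausdorffMeasure n : Measure (EuclideanSpace ℝ (Fin d)))
      (F '' Metric.closedBall (W.orthogonalProjectionOnto y) r) ≤
      ((1 + K : ℝ≥0) : ℝ≥0∞) ^ n * (Measure.euclideanHausdorffMeasure n : Measure W)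
        (Metric.closedBall (W.orthogonalProjectionOnto y) r) := by
    have := hFL.hausdorffMeasure_image_le (d := (n : ℝ)) (by positivity)
      (Metric.closedBall (W.orthogonalProjectionOnto y) r)
    rw [ENNReal.rpow_natCast] at this
    simp only [Measure.euclideanHausdorffMeasure_def, Measure.smul_apply, ENNReal.smul_def,
      smul_eq_mul]
    rw [mul_left_comm]
    gcongr
  refine h1.trans (le_of_eq ?_)
  rw [hvol, Measure.addHaar_closedBall _ _ hr.le, hfr, ENNReal.coe_mul, ENNReal.coe_toNNReal hfin,
    ENNReal.coe_pow, ENNReal.ofReal_pow hr.le]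
  ring

/-- Upper Ahlfors regularity of compact Lipschitz hypersurfaces. -/
theorem exists_surfaceMeasure_closedBall_le {d n : ℕ} (hd : d = n + 1)
    {Γ : Set (EuclideanSpace ℝ (Fin d))} (hc : IsCompact Γ) (hΓ : IsLipschitzHypersurface Γ) :
    ∃ A : ℝ≥0, ∀ y : EuclideanSpace ℝ (Fin d), ∀ r : ℝ, 0 < r →
      surfaceMeasure Γ (Metric.closedBall y r) ≤ A * ENNReal.ofReal r ^ n := by
  have hdn : d - 1 = n := by omega
  have key : ∃ A : ℝ≥0, ∀ y : EuclideanSpace ℝ (Fin d), ∀ r : ℝ, 0 < r →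
      (Measure.euclideanHausdorffMeasure n : Measure (EuclideanSpace ℝ (Fin d)))
        (Γ ∩ Γ ∩ Metric.closedBall y r) ≤ A * ENNReal.ofReal r ^ n := by
    -- The bound passes to subsets and to finite unions, so by compactness it need only hold near
    -- each point, where `Γ` is a graph.
    refine hc.induction_on (p := fun s => ∃ A : ℝ≥0, ∀ y : EuclideanSpace ℝ (Fin d), ∀ r : ℝ,
      0 < r → (Measure.euclideanHausdorffMeasure n : Measure (EuclideanSpace ℝ (Fin d)))
        (Γ ∩ s ∩ Metric.closedBall y r) ≤ A * ENNReal.ofReal r ^ n) ?_ ?_ ?_ ?_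
    · exact ⟨0, fun y r _ => by simp⟩
    · rintro s t hst ⟨A, hA⟩
      exact ⟨A, fun y r hr => (measure_mono (by gcongr)).trans (hA y r hr)⟩
    · rintro s t ⟨A, hA⟩ ⟨A', hA'⟩
      refine ⟨A + A', fun y r hr => ?_⟩
      rw [inter_union_distrib_left, union_inter_distrib_right, ENNReal.coe_add, add_mul]
      exact (measure_union_le _ _).trans (add_le_add (hA y r hr) (hA' y r hr))
    · intro p hp
      obtain ⟨U, hU, hpU, ν, hν, K, h, hh, hgr⟩ := hΓ p hp
      obtain ⟨A, hA⟩ := exists_measure_lipschitz_graph_inter_closedBall_le hd hν rfl hh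
      refine ⟨U, mem_nhdsWithin_of_mem_nhds (hU.mem_nhds hpU), A, fun y r hr => ?_⟩
      rw [hgr]
      exact (measure_mono (inter_subset_inter_left _ inter_subset_left)).trans (hA y r hr)
  obtain ⟨A, hA⟩ := key
  refine ⟨A, fun y r hr => ?_⟩
  have := hA y r hr
  rw [inter_self, inter_comm] at this
  rw [surfaceMeasure, hdn, Measure.restrict_apply Metric.isClosed_closedBall.measurableSet]
  exact this

/-- Dyadic decomposition of a polynomially decaying function into indicators of balls. -/
theorem ofReal_one_add_inv_pow_le {t : ℝ} (ht : 0 ≤ t) (N : ℕ) :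
    ENNReal.ofReal (((1 + t) ^ N)⁻¹) ≤
      2 ^ N * ∑' j : ℕ, (2⁻¹ ^ j) ^ N * (if t ≤ 2 ^ j then 1 else 0) := by
  have hex : ∃ j : ℕ, t ≤ 2 ^ j := by
    obtain ⟨n, hn⟩ := pow_unbounded_of_one_lt t (one_lt_two (α := ℝ))
    exact ⟨n, hn.le⟩
  have key : ∃ j : ℕ, t ≤ 2 ^ j ∧ (2 : ℝ) ^ j / 2 ≤ 1 + t := by
    classical
    refine ⟨Nat.find hex, Nat.find_spec hex, ?_⟩
    rcases hj : Nat.find hex with _ | j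
    · norm_num; linarith
    · have := not_le.1 (Nat.find_min hex (m := j) (by omega))
      rw [pow_succ]; linarith
  obtain ⟨j, hj, hj'⟩ := key
  have h1 : ENNReal.ofReal (((1 + t) ^ N)⁻¹) ≤ 2 ^ N * (2⁻¹ ^ j) ^ N := by
    have : ((1 + t) ^ N)⁻¹ ≤ (2 * (2⁻¹) ^ j) ^ N := by
      calc ((1 + t) ^ N)⁻¹ ≤ (((2 : ℝ) ^ j / 2) ^ N)⁻¹ := by gcongr
        _ = _ := by rw [← inv_pow, inv_div, inv_pow, div_eq_mul_inv]
    refine (ENNReal.ofReal_le_ofReal this).trans (le_of_eq ?_)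
    rw [ENNReal.ofReal_pow (by positivity), ENNReal.ofReal_mul (by norm_num),
      ENNReal.ofReal_pow (by norm_num), ENNReal.ofReal_inv_of_pos (by norm_num), mul_pow]
    norm_num
  refine h1.trans ?_
  gcongr
  refine le_trans ?_ (ENNReal.le_tsum j)
  simp [hj]

/-- Integral of a polynomially decaying kernel at scale `R⁻¹` against an Ahlfors regular measure. -/
theorem lintegral_one_add_inv_pow_le {d m : ℕ} {μ : Measure (EuclideanSpace ℝ (Fin d))} {A : ℝ≥0}
    (hμ : ∀ y : EuclideanSpace ℝ (Fin d), ∀ r : ℝ, 0 < r →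
      μ (Metric.closedBall y r) ≤ A * ENNReal.ofReal r ^ m)
    {R : ℝ} (hR : 0 < R) (y : EuclideanSpace ℝ (Fin d)) :
    ∫⁻ x, ENNReal.ofReal (((1 + R * ‖x - y‖) ^ (m + 1))⁻¹) ∂μ ≤
      2 ^ (m + 2) * A * ENNReal.ofReal R⁻¹ ^ m := by
  have hset : ∀ j : ℕ, {x : EuclideanSpace ℝ (Fin d) | R * ‖x - y‖ ≤ 2 ^ j} =
      Metric.closedBall y (2 ^ j * R⁻¹) := fun j => by
    ext x
    rw [mem_ofPred_eq, Metric.mem_closedBall, dist_eq_norm, ← div_eq_mul_inv, le_div_iff₀' hR]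
  have hind : ∀ (j : ℕ) (x : EuclideanSpace ℝ (Fin d)),
      (if R * ‖x - y‖ ≤ 2 ^ j then (1 : ℝ≥0∞) else 0) =
        (Metric.closedBall y (2 ^ j * R⁻¹)).indicator 1 x := fun j x => by
    rw [← hset, indicator_apply]; rfl
  calc _ ≤ ∫⁻ x, 2 ^ (m + 1) * ∑' j : ℕ, (2⁻¹ ^ j) ^ (m + 1) *
        (Metric.closedBall y (2 ^ j * R⁻¹)).indicator 1 x ∂μ := by
        refine lintegral_mono fun x => ?_
        simp only [← hind]
        exact ofReal_one_add_inv_pow_le (by positivity) _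
    _ = 2 ^ (m + 1) * ∑' j : ℕ, (2⁻¹ ^ j) ^ (m + 1) *
        μ (Metric.closedBall y (2 ^ j * R⁻¹)) := by
        rw [lintegral_const_mul' _ _ (by finiteness), lintegral_tsum]
        · congr 1
          refine tsum_congr fun j => ?_
          rw [lintegral_const_mul' _ _ (by finiteness),
            lintegral_indicator_one Metric.isClosed_closedBall.measurableSet]
        · exact fun j => ((measurable_one.indicator
            Metric.isClosed_closedBall.measurableSet).const_mul _).aemeasurable
    -- The ball of radius `2^j/R` costs `2^(jm)`; decay of order `m + 1` beats it by exactly one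
    -- factor `2^(-j)`.
    _ ≤ 2 ^ (m + 1) * ∑' j : ℕ, (A * ENNReal.ofReal R⁻¹ ^ m) * 2⁻¹ ^ j := by
        refine mul_le_mul' le_rfl (ENNReal.tsum_le_tsum fun j => ?_)
        refine (mul_le_mul_right (hμ y (2 ^ j * R⁻¹) (by positivity)) _).trans (le_of_eq ?_)
        rw [ENNReal.ofReal_mul (by positivity), ENNReal.ofReal_pow (by norm_num), mul_pow]
        have h2 : (2⁻¹ ^ j : ℝ≥0∞) * ENNReal.ofReal 2 ^ j = 1 := by
          rw [← mul_pow, ENNReal.ofReal_ofNat, ENNReal.inv_mul_cancel (by norm_num) (by norm_num),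
            one_pow]
        calc _ = (A * ENNReal.ofReal R⁻¹ ^ m) * 2⁻¹ ^ j *
              ((2⁻¹ ^ j : ℝ≥0∞) * ENNReal.ofReal 2 ^ j) ^ m := by ring
          _ = _ := by rw [h2, one_pow, mul_one]
    _ = _ := by
        rw [ENNReal.tsum_mul_left, ENNReal.tsum_geometric, ENNReal.one_sub_inv_two, inv_inv]
        ring

/-! ### The kernel of `P_{≤ k}` and the trace estimate at one frequency scale. -/

/-- The operator `P_{≤ k}` on Schwartz functions. -/
noncomputable def lpLowSchwartz {d : ℕ} (φ : 𝓢(EuclideanSpace ℝ (Fin d), ℂ)) (k : ℤ) :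
    𝓢(EuclideanSpace ℝ (Fin d), ℂ) →L[ℂ] 𝓢(EuclideanSpace ℝ (Fin d), ℂ) :=
  SchwartzMap.fourierMultiplierCLM ℂ fun η => lowSymbol φ k ((2 * Real.pi) • η)

theorem two_pi_mul_inv_zpow_ne_zero (k : ℤ) : ((2 : ℝ) ^ k)⁻¹ * (2 * Real.pi) ≠ 0 := by
  positivity

/-- The convolution kernel of `P_{≤ k}`. -/
noncomputable def lowKernel {d : ℕ} (φ : 𝓢(EuclideanSpace ℝ (Fin d), ℂ)) (k : ℤ) :
    𝓢(EuclideanSpace ℝ (Fin d), ℂ) :=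
  𝓕⁻ (SchwartzMap.compCLMOfContinuousLinearEquiv ℂ
    (dilation d (((2 : ℝ) ^ k)⁻¹ * (2 * Real.pi)) (two_pi_mul_inv_zpow_ne_zero k)) φ)

theorem lpLowSchwartz_apply {d : ℕ} (φ : 𝓢(EuclideanSpace ℝ (Fin d), ℂ)) (k : ℤ)
    (F : 𝓢(EuclideanSpace ℝ (Fin d), ℂ)) (x : EuclideanSpace ℝ (Fin d)) :
    lpLowSchwartz φ k F x = ∫ y, lowKernel φ k (x - y) * F y := by
  have h : lpLowSchwartz φ k F =
      SchwartzMap.convolution (ContinuousLinearMap.mul ℂ ℂ) (lowKernel φ k) F := by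
    have hc : ∀ c : 𝓢(EuclideanSpace ℝ (Fin d), ℂ),
        𝓕⁻ (𝓕 c : 𝓢(EuclideanSpace ℝ (Fin d), ℂ)) = c :=
      FourierTransform.fourierInv_fourier_eq
    rw [← hc (SchwartzMap.convolution (ContinuousLinearMap.mul ℂ ℂ) (lowKernel φ k) F), SchwartzMap.fourier_convolution, lpLowSchwartz, SchwartzMap.fourierMultiplierCLM_apply]
    congr 1
    ext η
    rw [SchwartzMap.smulLeftCLM_apply_apply
      (hasTemperateGrowth_comp_two_pi (lowSymbol_hasTemperateGrowth φ k)), lowKernel,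
      FourierTransform.fourier_fourierInv_eq]
    change φ (((2 : ℝ) ^ k)⁻¹ • (2 * Real.pi) • η) * _ =
      φ ((((2 : ℝ) ^ k)⁻¹ * (2 * Real.pi)) • η) * _
    rw [smul_smul]
  rw [h, SchwartzMap.convolution_apply, convolution_eq_swap]
  rfl

theorem lowKernel_apply {d : ℕ} (φ : 𝓢(EuclideanSpace ℝ (Fin d), ℂ)) (k : ℤ)
    (x : EuclideanSpace ℝ (Fin d)) :
    lowKernel φ k x = ((((2 : ℝ) ^ k) ^ d : ℝ) : ℂ) * lowKernel φ 0 ((2 : ℝ) ^ k • x) := by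
  have h2 : (0 : ℝ) < 2 ^ k := by positivity
  simp only [lowKernel, SchwartzMap.fourierInv_coe, Real.fourierInv_eq]
  have := Measure.integral_comp_inv_smul volume (fun v : EuclideanSpace ℝ (Fin d) =>
    Real.fourierChar ⟪v, (2 : ℝ) ^ k • x⟫ • φ ((2 * Real.pi) • v)) ((2 : ℝ) ^ k)
  rw [finrank_euclideanSpace_fin, abs_of_pos (by positivity), Complex.real_smul] at this
  refine Eq.trans (integral_congr_ae (.of_forall fun v => ?_))
    (this.trans (congrArg _ (integral_congr_ae (.of_forall fun v => ?_))))
  · change _ • φ ((((2 : ℝ) ^ k)⁻¹ * (2 * Real.pi)) • v) =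
      Real.fourierChar ⟪((2 : ℝ) ^ k)⁻¹ • v, (2 : ℝ) ^ k • x⟫ •
        φ ((2 * Real.pi) • ((2 : ℝ) ^ k)⁻¹ • v)
    rw [inner_smul_left, inner_smul_right, smul_smul, mul_comm (2 * Real.pi)]
    simp only [RCLike.conj_to_real]
    rw [inv_mul_cancel_left₀ h2.ne']
  · change _ = _ • φ ((((2 : ℝ) ^ (0 : ℤ))⁻¹ * (2 * Real.pi)) • v)
    simp

theorem exists_norm_lowKernel_le {d : ℕ} (φ : 𝓢(EuclideanSpace ℝ (Fin d), ℂ)) (N : ℕ) :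
    ∃ C : ℝ≥0, ∀ (k : ℤ) (x : EuclideanSpace ℝ (Fin d)),
      ‖lowKernel φ k x‖ ≤ C * ((2 : ℝ) ^ k) ^ d * ((1 + 2 ^ k * ‖x‖) ^ N)⁻¹ := by
  obtain ⟨C, hC⟩ : ∃ C : ℝ≥0, ∀ x, (1 + ‖x‖) ^ N * ‖lowKernel φ 0 x‖ ≤ C := by
    have h := fun x => SchwartzMap.one_add_le_sup_seminorm_apply (𝕜 := ℝ) (m := (N, 0)) le_rfl
      le_rfl (lowKernel φ 0) x
    simp only [norm_iteratedFDeriv_zero] at h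
    exact ⟨⟨_, le_trans (by positivity) (h 0)⟩, h⟩
  refine ⟨C, fun k x => ?_⟩
  have h2 : (0 : ℝ) < 2 ^ k := by positivity
  rw [lowKernel_apply, norm_mul, Complex.norm_real, Real.norm_of_nonneg (by positivity)]
  have h := hC ((2 : ℝ) ^ k • x)
  rw [norm_smul, Real.norm_of_nonneg h2.le] at h
  rw [← div_eq_mul_inv, le_div_iff₀ (by positivity)]
  calc _ = ((2 : ℝ) ^ k) ^ d * ((1 + 2 ^ k * ‖x‖) ^ N * ‖lowKernel φ 0 ((2 : ℝ) ^ k • x)‖) := by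
        ring
    _ ≤ ((2 : ℝ) ^ k) ^ d * C := by gcongr
    _ = _ := by ring

/-- Cauchy-Schwarz with a weight. -/
theorem lintegral_mul_sq_le {α : Type*} [MeasurableSpace α] {μ : Measure α} {k f : α → ℝ≥0∞}
    (hk : AEMeasurable k μ) (hf : AEMeasurable f μ) :
    (∫⁻ x, k x * f x ∂μ) ^ 2 ≤ (∫⁻ x, k x ∂μ) * ∫⁻ x, k x * f x ^ 2 ∂μ := by
  have h := ENNReal.lintegral_mul_le_Lp_mul_Lq μ Real.HolderConjugate.two_two
    (hk.pow_const (1 / 2 : ℝ)) ((hk.pow_const (1 / 2 : ℝ)).mul hf)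
  have e1 : ∀ x, k x ^ (1 / 2 : ℝ) * (k x ^ (1 / 2 : ℝ) * f x) = k x * f x := fun x => by
    rw [← mul_assoc, ← ENNReal.rpow_add_of_nonneg _ _ (by norm_num) (by norm_num)]
    norm_num
  have e2 : ∀ x, (k x ^ (1 / 2 : ℝ)) ^ (2 : ℝ) = k x := fun x => by
    rw [← ENNReal.rpow_mul]; norm_num
  simp only [Pi.mul_apply, e1, ENNReal.mul_rpow_of_nonneg _ _ (zero_le_two (α := ℝ)), e2] at h
  calc _ ≤ _ := pow_le_pow_left' h 2
    _ = _ := by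
      rw [mul_pow, ← ENNReal.rpow_natCast, ← ENNReal.rpow_natCast, ← ENNReal.rpow_mul,
        ← ENNReal.rpow_mul]
      norm_num

/-- Peetre's inequality at scale `R ≥ 1`. -/
theorem peetre_inv_sq_le {d : ℕ} {x y : EuclideanSpace ℝ (Fin d)} {M R : ℝ} (hx : ‖x‖ ≤ M)
    (hR : 1 ≤ R) : ((1 + R * ‖x - y‖) ^ 2)⁻¹ ≤ (1 + M) ^ 2 * ((1 + ‖y‖) ^ 2)⁻¹ := by
  have hM : 0 ≤ M := (norm_nonneg x).trans hx
  have h1 : 1 + ‖y‖ ≤ (1 + M) * (1 + R * ‖x - y‖) := by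
    have h2 : ‖y‖ ≤ ‖x‖ + ‖x - y‖ := by
      have := norm_sub_le x (x - y); simpa using this
    have h3 : ‖x - y‖ ≤ R * ‖x - y‖ := le_mul_of_one_le_left (norm_nonneg _) hR
    nlinarith [mul_nonneg hM (mul_nonneg (zero_le_one.trans hR) (norm_nonneg (x - y)))]
  rw [← div_eq_mul_inv, inv_eq_one_div, div_le_div_iff₀ (by positivity) (by positivity), one_mul,
    ← mul_pow]
  gcongr

/-- The trace estimate for frequencies `≲ 2^k`, with a decaying weight. -/
theorem exists_lintegral_lpLowSchwartz_le {d m : ℕ} (hd : d = m + 1)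
    (φ : 𝓢(EuclideanSpace ℝ (Fin d), ℂ)) {μ : Measure (EuclideanSpace ℝ (Fin d))} [SFinite μ]
    {A : ℝ≥0} (hμ : ∀ y : EuclideanSpace ℝ (Fin d), ∀ r : ℝ, 0 < r →
      μ (Metric.closedBall y r) ≤ A * ENNReal.ofReal r ^ m)
    {M : ℝ} (hM : ∀ᵐ x ∂μ, ‖x‖ ≤ M) :
    ∃ C : ℝ≥0, ∀ (k : ℤ), 0 ≤ k → ∀ F : 𝓢(EuclideanSpace ℝ (Fin d), ℂ),
      ∫⁻ x, ‖lpLowSchwartz φ k F x‖ₑ ^ 2 ∂μ ≤ C * ENNReal.ofReal (2 ^ k) *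
        ∫⁻ y, ENNReal.ofReal (((1 + ‖y‖) ^ 2)⁻¹) * ‖F y‖ₑ ^ 2 := by
  -- Of these `d + 2` powers of decay, `d = m + 1` make the kernel integrable against `μ` and the
  -- other two pay for the weight through Peetre's inequality.
  obtain ⟨C, hC⟩ := exists_norm_lowKernel_le φ (d + 2)
  obtain ⟨A', hA'⟩ : ∃ A' : ℝ≥0, ∀ y : EuclideanSpace ℝ (Fin d), ∀ r : ℝ, 0 < r →
      (volume : Measure (EuclideanSpace ℝ (Fin d))) (Metric.closedBall y r) ≤
        A' * ENNReal.ofReal r ^ d := by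
    refine ⟨((volume : Measure (EuclideanSpace ℝ (Fin d))) (Metric.ball 0 1)).toNNReal,
      fun y r hr => le_of_eq ?_⟩
    rw [ENNReal.coe_toNNReal measure_ball_lt_top.ne, Measure.addHaar_closedBall _ _ hr.le,
      finrank_euclideanSpace_fin, ENNReal.ofReal_pow hr.le, mul_comm]
  refine ⟨(C * (2 ^ (d + 2) * A')) * (C * (2 ^ (m + 2) * A) * Real.toNNReal ((1 + M) ^ 2)),
    fun k hk F => ?_⟩
  set R : ℝ := 2 ^ k with hRdef
  have hR : 1 ≤ R := one_le_zpow₀ (by norm_num) hk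
  have hR0 : 0 < R := by positivity
  have hRR : ENNReal.ofReal R * ENNReal.ofReal R⁻¹ = 1 := by
    rw [← ENNReal.ofReal_mul hR0.le, mul_inv_cancel₀ hR0.ne', ENNReal.ofReal_one]
  have hker : ∀ x y : EuclideanSpace ℝ (Fin d), ‖lowKernel φ k (x - y)‖ₑ ≤
      C * ENNReal.ofReal R ^ d * ENNReal.ofReal (((1 + R * ‖x - y‖) ^ (d + 2))⁻¹) := fun x y => by
    rw [← ofReal_norm]
    refine (ENNReal.ofReal_le_ofReal (hC k (x - y))).trans (le_of_eq ?_)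
    rw [ENNReal.ofReal_mul (by positivity), ENNReal.ofReal_mul (by positivity),
      ENNReal.ofReal_coe_nnreal, ENNReal.ofReal_pow hR0.le]
  have hL1 : ∀ x : EuclideanSpace ℝ (Fin d),
      ∫⁻ y, ‖lowKernel φ k (x - y)‖ₑ ≤ C * (2 ^ (d + 2) * A') := fun x => by
    calc _ ≤ ∫⁻ y, C * ENNReal.ofReal R ^ d *
          ENNReal.ofReal (((1 + R * ‖y - x‖) ^ (d + 1))⁻¹) := by
          refine lintegral_mono fun y => (hker x y).trans ?_
          rw [norm_sub_rev]
          have : 0 ≤ R * ‖y - x‖ := by positivity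
          gcongr <;> first | omega | linarith
      _ = C * ENNReal.ofReal R ^ d *
          ∫⁻ y, ENNReal.ofReal (((1 + R * ‖y - x‖) ^ (d + 1))⁻¹) :=
          lintegral_const_mul' _ _ (by finiteness)
      _ ≤ C * ENNReal.ofReal R ^ d * (2 ^ (d + 2) * A' * ENNReal.ofReal R⁻¹ ^ d) := by
          gcongr
          exact lintegral_one_add_inv_pow_le hA' hR0 x
      _ = C * (2 ^ (d + 2) * A') * (ENNReal.ofReal R * ENNReal.ofReal R⁻¹) ^ d := by ring
      _ = _ := by rw [hRR, one_pow, mul_one]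
  -- Height `R^d` against `R^(-m)` from regularity of `μ`: the surplus `R` is the loss of half a
  -- derivative in the trace. Peetre's inequality uses `R ≥ 1`, hence the restriction to `k ≥ 0`.
  have hL2 : ∀ y : EuclideanSpace ℝ (Fin d), ∫⁻ x, ‖lowKernel φ k (x - y)‖ₑ ∂μ ≤
      (C * (2 ^ (m + 2) * A) * Real.toNNReal ((1 + M) ^ 2)) * ENNReal.ofReal R *
        ENNReal.ofReal (((1 + ‖y‖) ^ 2)⁻¹) := fun y => by
    set w := ENNReal.ofReal ((1 + M) ^ 2) * ENNReal.ofReal (((1 + ‖y‖) ^ 2)⁻¹) with hw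
    calc _ ≤ ∫⁻ x, C * ENNReal.ofReal R ^ d * w *
          ENNReal.ofReal (((1 + R * ‖x - y‖) ^ (m + 1))⁻¹) ∂μ := by
          refine lintegral_mono_ae ?_
          filter_upwards [hM] with x hx
          refine (hker x y).trans ?_
          rw [mul_assoc _ w]
          gcongr
          rw [hw, ← ENNReal.ofReal_mul (by positivity), ← ENNReal.ofReal_mul (by positivity)]
          refine ENNReal.ofReal_le_ofReal ?_
          rw [pow_add, mul_inv, mul_comm,
            show (1 + R * ‖x - y‖) ^ d = (1 + R * ‖x - y‖) ^ (m + 1) from congrArg _ hd]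
          gcongr
          exact peetre_inv_sq_le hx hR
      _ = C * ENNReal.ofReal R ^ d * w *
          ∫⁻ x, ENNReal.ofReal (((1 + R * ‖x - y‖) ^ (m + 1))⁻¹) ∂μ :=
          lintegral_const_mul' _ _ (by finiteness)
      _ ≤ C * ENNReal.ofReal R ^ d * w * (2 ^ (m + 2) * A * ENNReal.ofReal R⁻¹ ^ m) := by
          gcongr
          exact lintegral_one_add_inv_pow_le hμ hR0 y
      _ = C * (2 ^ (m + 2) * A) * w * ENNReal.ofReal R *
          (ENNReal.ofReal R * ENNReal.ofReal R⁻¹) ^ m := by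
          rw [show ENNReal.ofReal R ^ d = ENNReal.ofReal R ^ (m + 1) by rw [hd]]; ring
      _ = _ := by
          rw [hRR, one_pow, mul_one, hw]
          change _ = C * (2 ^ (m + 2) * A) * ENNReal.ofReal ((1 + M) ^ 2) * _ * _
          ring
  -- Cauchy-Schwarz with the kernel as weight; integrating in `x` against `μ` then puts `hL2` on the
  -- remaining kernel.
  have hpt : ∀ x : EuclideanSpace ℝ (Fin d), ‖lpLowSchwartz φ k F x‖ₑ ^ 2 ≤
      C * (2 ^ (d + 2) * A') * ∫⁻ y, ‖lowKernel φ k (x - y)‖ₑ * ‖F y‖ₑ ^ 2 := fun x => by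
    have hcont : Continuous fun y => lowKernel φ k (x - y) := by fun_prop
    calc _ ≤ (∫⁻ y, ‖lowKernel φ k (x - y)‖ₑ * ‖F y‖ₑ) ^ 2 := by
          rw [lpLowSchwartz_apply]
          gcongr
          refine (enorm_integral_le_lintegral_enorm _).trans (le_of_eq ?_)
          simp only [enorm_mul]
      _ ≤ (∫⁻ y, ‖lowKernel φ k (x - y)‖ₑ) * ∫⁻ y, ‖lowKernel φ k (x - y)‖ₑ * ‖F y‖ₑ ^ 2 :=
          lintegral_mul_sq_le hcont.enorm.measurable.aemeasurable
            F.continuous.enorm.measurable.aemeasurable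
      _ ≤ _ := by gcongr; exact hL1 x
  calc ∫⁻ x, ‖lpLowSchwartz φ k F x‖ₑ ^ 2 ∂μ ≤ ∫⁻ x, C * (2 ^ (d + 2) * A') *
        ∫⁻ y, ‖lowKernel φ k (x - y)‖ₑ * ‖F y‖ₑ ^ 2 ∂volume ∂μ := lintegral_mono hpt
    _ = C * (2 ^ (d + 2) * A') *
        ∫⁻ x, ∫⁻ y, ‖lowKernel φ k (x - y)‖ₑ * ‖F y‖ₑ ^ 2 ∂volume ∂μ :=
        lintegral_const_mul' _ _ (by finiteness)
    _ = C * (2 ^ (d + 2) * A') *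
        ∫⁻ y, ∫⁻ x, ‖lowKernel φ k (x - y)‖ₑ * ‖F y‖ₑ ^ 2 ∂μ ∂volume := by
        rw [lintegral_lintegral_swap]
        refine Measurable.aemeasurable ?_
        refine Measurable.mul (f := fun p : EuclideanSpace ℝ (Fin d) × EuclideanSpace ℝ (Fin d) =>
          ‖lowKernel φ k (p.1 - p.2)‖ₑ) (g := fun p => ‖F p.2‖ₑ ^ 2) ?_ ?_
        · exact ((lowKernel φ k).continuous.comp
            (continuous_fst.sub continuous_snd)).enorm.measurable
        · exact ((F.continuous.comp continuous_snd).enorm.measurable).pow_const 2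
    _ ≤ C * (2 ^ (d + 2) * A') *
        ∫⁻ y, (C * (2 ^ (m + 2) * A) * Real.toNNReal ((1 + M) ^ 2)) * ENNReal.ofReal R *
          (ENNReal.ofReal (((1 + ‖y‖) ^ 2)⁻¹) * ‖F y‖ₑ ^ 2) := by
        gcongr with y
        rw [lintegral_mul_const' _ _ (by finiteness), ← mul_assoc]
        gcongr
        exact hL2 y
    _ = _ := by
        rw [lintegral_const_mul' _ _ (by finiteness)]
        push_cast
        ring

/-! ### The pieces of the `Y_λ^*` norm. -/

section YStarNorm

variable {d : ℕ} (φ : 𝓢(EuclideanSpace ℝ (Fin d), ℂ)) (lam : ℝ)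
  (u : 𝓢'(EuclideanSpace ℝ (Fin d), ℂ))

theorem yStarNorm_sq : yStarNorm φ lam u ^ 2 =
    distNorm (mNorm lam) (hatD d (lpLow φ (critScale lam - 3) u)) ^ 2
    + ∑ k ∈ Finset.Icc (critScale lam - 2) (critScale lam + 1),
        ENNReal.ofReal (Real.sqrt lam) * distNorm ahNorm (lpProj φ k u) ^ 2
    + ∑' k : {k : ℤ // critScale lam + 1 < k},
        distNorm (mNorm lam) (hatD d (lpProj φ k u)) ^ 2 := by
  rw [yStarNorm, ← ENNReal.rpow_natCast, ← ENNReal.rpow_mul]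
  norm_num

theorem low_le_yStarNorm :
    distNorm (mNorm lam) (hatD d (lpLow φ (critScale lam - 3) u)) ≤ yStarNorm φ lam u := by
  rw [← ENNReal.pow_le_pow_left_iff two_ne_zero, yStarNorm_sq, add_assoc]
  exact le_self_add

theorem critical_le_yStarNorm_sq {k : ℤ} (hk : critScale lam - 2 ≤ k)
    (hk' : k ≤ critScale lam + 1) :
    ENNReal.ofReal (Real.sqrt lam) * distNorm ahNorm (lpProj φ k u) ^ 2 ≤
      yStarNorm φ lam u ^ 2 := by
  rw [yStarNorm_sq]
  refine le_trans ?_ le_self_add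
  refine le_trans ?_ le_add_self
  exact Finset.single_le_sum (f := fun k => ENNReal.ofReal (Real.sqrt lam) *
    distNorm ahNorm (lpProj φ k u) ^ 2) (fun _ _ => zero_le) (Finset.mem_Icc.2 ⟨hk, hk'⟩)

theorem high_le_yStarNorm {k : ℤ} (hk : critScale lam + 1 < k) :
    distNorm (mNorm lam) (hatD d (lpProj φ k u)) ≤ yStarNorm φ lam u := by
  rw [← ENNReal.pow_le_pow_left_iff two_ne_zero, yStarNorm_sq]
  refine le_trans ?_ le_add_self
  exact ENNReal.le_tsum (f := fun k : {k : ℤ // critScale lam + 1 < k} =>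
    distNorm (mNorm lam) (hatD d (lpProj φ k u)) ^ 2) ⟨k, hk⟩

end YStarNorm

theorem one_le_critScale {lam : ℝ} (h : 1 < lam) : 1 ≤ critScale lam := by
  by_contra! hk
  have h1 := (critScale_spec (zero_lt_one.trans h)).2
  have h2 : (1 : ℝ) < Real.sqrt lam := by rw [Real.lt_sqrt zero_le_one]; simpa using h
  have h3 : (2 : ℝ) ^ critScale lam ≤ 1 := zpow_le_one_of_nonpos₀ (by norm_num) (by omega)
  linarith

/-! ### Summation over scales: the trace inequality. -/

theorem lpLow_toTemperedDistributionCLM {d : ℕ} (φ : 𝓢(EuclideanSpace ℝ (Fin d), ℂ)) (k : ℤ)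
    (F : 𝓢(EuclideanSpace ℝ (Fin d), ℂ)) :
    lpLow φ k (SchwartzMap.toTemperedDistributionCLM (EuclideanSpace ℝ (Fin d)) ℂ volume F) =
      SchwartzMap.toTemperedDistributionCLM (EuclideanSpace ℝ (Fin d)) ℂ volume
        (lpLowSchwartz φ k F) :=
  TemperedDistribution.fourierMultiplierCLM_toTemperedDistributionCLM_eq
    (hasTemperateGrowth_comp_two_pi (lowSymbol_hasTemperateGrowth φ k)) F

theorem lpProj_toTemperedDistributionCLM {d : ℕ} (φ : 𝓢(EuclideanSpace ℝ (Fin d), ℂ)) (k : ℤ)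
    (F : 𝓢(EuclideanSpace ℝ (Fin d), ℂ)) :
    lpProj φ k (SchwartzMap.toTemperedDistributionCLM (EuclideanSpace ℝ (Fin d)) ℂ volume F) =
      SchwartzMap.toTemperedDistributionCLM (EuclideanSpace ℝ (Fin d)) ℂ volume
        (lpLowSchwartz φ k F - lpLowSchwartz φ (k - 1) F) := by
  rw [lpProj_eq_sub, lpLow_toTemperedDistributionCLM, lpLow_toTemperedDistributionCLM, map_sub]

/-- The symbol at scale `n` equals one on the support of the symbol at scale `k`. The trace
estimate, stated for a projected function, thereby applies to band-limited pieces themselves. -/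
theorem lpLowSchwartz_lpLowSchwartz {d : ℕ} {φ : 𝓢(EuclideanSpace ℝ (Fin d), ℂ)}
    (hφ : IsLPBase φ) {k n : ℤ} (h : k + 1 ≤ n) (F : 𝓢(EuclideanSpace ℝ (Fin d), ℂ)) :
    lpLowSchwartz φ n (lpLowSchwartz φ k F) = lpLowSchwartz φ k F := by
  unfold lpLowSchwartz
  rw [SchwartzMap.fourierMultiplierCLM_fourierMultiplierCLM_apply
    (hasTemperateGrowth_comp_two_pi (lowSymbol_hasTemperateGrowth φ n))
    (hasTemperateGrowth_comp_two_pi (lowSymbol_hasTemperateGrowth φ k))]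
  congr 2
  ext η
  rw [Pi.mul_apply]
  rcases le_or_gt ‖(2 * Real.pi) • η‖ (2 ^ n) with h1 | h1
  · rw [lowSymbol_eq_one hφ h1, one_mul]
  · have h2 : 2 * (2 : ℝ) ^ k ≤ 2 ^ n := by
      rw [mul_comm, ← zpow_add_one₀ two_ne_zero]
      exact zpow_le_zpow_right₀ (by norm_num) h
    rw [lowSymbol_eq_zero hφ (h2.trans_lt h1), mul_zero]

/-- Dominated convergence in Fourier inversion: at each frequency the symbol is eventually equal to
one. Pointwise convergence everywhere is needed because `Γ` is a Lebesgue null set. -/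
theorem tendsto_lpLowSchwartz {d : ℕ} {φ : 𝓢(EuclideanSpace ℝ (Fin d), ℂ)} (hφ : IsLPBase φ)
    (k : ℤ) (F : 𝓢(EuclideanSpace ℝ (Fin d), ℂ)) (x : EuclideanSpace ℝ (Fin d)) :
    Filter.Tendsto (fun n : ℕ => lpLowSchwartz φ (k + n) F x) Filter.atTop (nhds (F x)) := by
  obtain ⟨B, hB, hφB, -⟩ := exists_norm_symbol_le φ
  have hF : F x = ∫ η, Real.fourierChar ⟪η, x⟫ • (𝓕 F) η := by
    have hc : 𝓕⁻ (𝓕 F : 𝓢(EuclideanSpace ℝ (Fin d), ℂ)) = F :=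
      FourierTransform.fourierInv_fourier_eq F
    conv_lhs => rw [← hc, SchwartzMap.fourierInv_coe, Real.fourierInv_eq]
  have hP : ∀ n : ℤ, lpLowSchwartz φ n F x =
      ∫ η, Real.fourierChar ⟪η, x⟫ • (lowSymbol φ n ((2 * Real.pi) • η) * (𝓕 F) η) := fun n => by
    rw [lpLowSchwartz, SchwartzMap.fourierMultiplierCLM_apply, SchwartzMap.fourierInv_coe,
      Real.fourierInv_eq]
    simp only [SchwartzMap.smulLeftCLM_apply_apply
      (hasTemperateGrowth_comp_two_pi (lowSymbol_hasTemperateGrowth φ n)), smul_eq_mul]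
  rw [hF]
  simp only [hP]
  refine tendsto_integral_of_dominated_convergence (fun η => B * ‖(𝓕 F) η‖) (fun n => ?_)
    ((𝓕 F : 𝓢(EuclideanSpace ℝ (Fin d), ℂ)).integrable.norm.const_mul B) (fun n => ?_) ?_
  · refine Continuous.aestronglyMeasurable ?_
    have h1 : Continuous (lowSymbol φ (k + n)) :=
      (lowSymbol_hasTemperateGrowth φ (k + n)).1.continuous
    have h2 := (𝓕 F : 𝓢(EuclideanSpace ℝ (Fin d), ℂ)).continuous
    simp only [Circle.smul_def]
    fun_prop
  · refine .of_forall fun η => ?_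
    rw [Circle.norm_smul, norm_mul]
    exact mul_le_mul_of_nonneg_right (hφB _ _) (norm_nonneg _)
  · refine .of_forall fun η => tendsto_const_nhds.congr' ?_
    obtain ⟨N, hN⟩ := pow_unbounded_of_one_lt (‖(2 * Real.pi) • η‖ * 2 ^ (-k)) (one_lt_two (α := ℝ))
    filter_upwards [Filter.eventually_ge_atTop N] with n hn
    rw [lowSymbol_eq_one hφ, one_mul]
    rw [zpow_add₀ two_ne_zero, zpow_natCast]
    have h1 : (2 : ℝ) ^ N ≤ 2 ^ n := pow_le_pow_right₀ (by norm_num) hn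
    rw [zpow_neg, ← div_eq_mul_inv, div_lt_iff₀ (by positivity)] at hN
    nlinarith [show (0 : ℝ) < 2 ^ k by positivity]

theorem lowWeight_le_one {d : ℕ} (y : EuclideanSpace ℝ (Fin d)) :
    ENNReal.ofReal (((1 + ‖y‖) ^ 2)⁻¹) ≤ 1 := by
  rw [ENNReal.ofReal_le_one]
  refine inv_le_one_of_one_le₀ (one_le_pow₀ ?_)
  linarith [norm_nonneg y]

/-- The trace inequality for the space `Y_λ^*`. -/
theorem exists_eLpNorm_surfaceMeasure_le {d : ℕ} (hd : 2 ≤ d)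
    (φ : 𝓢(EuclideanSpace ℝ (Fin d), ℂ)) (hφ : IsLPBase φ)
    {Γ : Set (EuclideanSpace ℝ (Fin d))} (hc : IsCompact Γ) (hΓ : IsLipschitzHypersurface Γ) :
    ∃ C : ℝ≥0, 0 < C ∧ ∀ lam : ℝ, 1 < lam → ∀ f : 𝓢(EuclideanSpace ℝ (Fin d), ℂ),
      eLpNorm f 2 (surfaceMeasure Γ) ≤ C * yStarNorm φ lam
        (SchwartzMap.toTemperedDistributionCLM (EuclideanSpace ℝ (Fin d)) ℂ volume f) := by
  obtain ⟨m, rfl⟩ : ∃ m, d = m + 1 := ⟨d - 1, by omega⟩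
  obtain ⟨A, hA⟩ := exists_surfaceMeasure_closedBall_le rfl hc hΓ
  set σ := surfaceMeasure Γ with hσ
  obtain ⟨M, hM⟩ := hc.isBounded.subset_closedBall 0
  have hae : ∀ᵐ x ∂σ, ‖x‖ ≤ M := by
    filter_upwards [ae_restrict_mem hc.measurableSet] with x hx
    exact mem_closedBall_zero_iff.1 (hM hx)
  have hfin : IsFiniteMeasure σ := by
    refine ⟨?_⟩
    have h1 : σ univ ≤ σ (Metric.closedBall 0 (max M 1)) := by
      refine measure_mono_ae ?_
      filter_upwards [hae] with x hx _
      exact mem_closedBall_zero_iff.2 (hx.trans (le_max_left _ _))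
    exact h1.trans_lt ((hA 0 _ (by positivity)).trans_lt (by finiteness))
  obtain ⟨C, hC⟩ := exists_lintegral_lpLowSchwartz_le rfl φ hA hae
  have trace_L2 : ∀ (n : ℤ), 0 ≤ n → ∀ F, lpLowSchwartz φ n F = F →
      eLpNorm F 2 σ ^ 2 ≤ C * ENNReal.ofReal (2 ^ n) * eLpNorm F 2 volume ^ 2 := by
    intro n hn F hF
    have h := hC n hn F
    rw [hF] at h
    rw [eLpNorm_two_sq, eLpNorm_two_sq]
    refine h.trans (mul_le_mul' le_rfl (lintegral_mono fun y => ?_))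
    exact mul_le_of_le_one_left' (lowWeight_le_one y)
  have trace_ah : ∀ (n : ℤ), 0 ≤ n → ∀ F, lpLowSchwartz φ n F = F →
      eLpNorm F 2 σ ^ 2 ≤ C * ENNReal.ofReal (2 ^ n) * (8 * ahNorm F ^ 2) := by
    intro n hn F hF
    have h := hC n hn F
    rw [hF] at h
    rw [eLpNorm_two_sq]
    exact h.trans (mul_le_mul' le_rfl (lintegral_weight_le_ahNorm F))
  -- The worst case for `512` is the critical range, where it arises as `4 · 2 · 64`. Adding one
  -- gives `D ≤ D^2`, so no square root of `C` is needed.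
  set D : ℝ≥0 := 512 * C + 1 with hD
  refine ⟨D * 5, by positivity, fun lam hlam f => ?_⟩
  have hl : 0 < lam := zero_lt_one.trans hlam
  set T := SchwartzMap.toTemperedDistributionCLM (EuclideanSpace ℝ (Fin (m + 1))) ℂ volume f with hT
  set N := yStarNorm φ lam T with hN
  set k₀ := critScale lam with hk₀
  have hk1 : 1 ≤ k₀ := one_le_critScale hlam
  -- The rational `3/4` replaces `2^(-1/2)`, as `(3/4)^2 ≥ 1/2`.
  have of_sq : ∀ {a : ℝ≥0∞} (j : ℕ), a ^ 2 ≤ 512 * C * (2⁻¹) ^ j * N ^ 2 →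
      a ≤ D * ENNReal.ofReal (3 / 4) ^ j * N := by
    intro a j ha
    rw [← ENNReal.pow_le_pow_left_iff two_ne_zero]
    refine ha.trans ?_
    rw [mul_pow, mul_pow]
    refine mul_le_mul' (mul_le_mul' ?_ ?_) le_rfl
    · have : (512 * C : ℝ≥0) ≤ D ^ 2 := by
        rw [hD]
        calc 512 * C ≤ 512 * C + 1 := le_self_add
          _ ≤ _ := le_self_pow₀ (by simp) two_ne_zero
      exact_mod_cast this
    · rw [← pow_mul, mul_comm j 2, pow_mul]
      refine pow_le_pow_left' ?_ j
      rw [← ENNReal.ofReal_pow (by norm_num), ← ENNReal.ofReal_ofNat 2,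
        ← ENNReal.ofReal_inv_of_pos (by norm_num)]
      exact ENNReal.ofReal_le_ofReal (by norm_num)
  have low : eLpNorm (lpLowSchwartz φ (k₀ - 3) f) 2 σ ≤ D * N := by
    -- Scale `k₀ - 2` would already reproduce this piece but may be negative; `k₀` is not.
    have h1 := trace_L2 k₀ (by omega) _
      (lpLowSchwartz_lpLowSchwartz hφ (k := k₀ - 3) (by omega) f)
    have h2 : eLpNorm (lpLowSchwartz φ (k₀ - 3) f) 2 volume ≤
        ENNReal.ofReal (4 * ((2 : ℝ) ^ k₀)⁻¹) * N := by
      refine (eLpNorm_le_distNorm (represents_toTemperedDistributionCLM _)).trans ?_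
      rw [← lpLow_toTemperedDistributionCLM]
      refine (distNorm_lpLow_le hφ hl T).trans ?_
      gcongr
      exact low_le_yStarNorm φ lam T
    have := of_sq (a := eLpNorm (lpLowSchwartz φ (k₀ - 3) f) 2 σ) 0 ?_
    · simpa using this
    · refine h1.trans ?_
      calc _ ≤ C * ENNReal.ofReal (2 ^ k₀) * (ENNReal.ofReal (4 * ((2 : ℝ) ^ k₀)⁻¹) * N) ^ 2 := by
            gcongr
        _ = C * ENNReal.ofReal (2 ^ k₀ * (4 * ((2 : ℝ) ^ k₀)⁻¹) ^ 2) * N ^ 2 := by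
            rw [ENNReal.ofReal_mul (p := (2 : ℝ) ^ _) (by positivity),
              ENNReal.ofReal_pow (by positivity)]; ring
        _ ≤ C * ENNReal.ofReal 512 * N ^ 2 := by
            refine mul_le_mul' (mul_le_mul' le_rfl (ENNReal.ofReal_le_ofReal ?_)) le_rfl
            have h3 : (1 : ℝ) ≤ 2 ^ k₀ := one_le_zpow₀ (by norm_num) (by omega)
            have h4 : ((2 : ℝ) ^ k₀)⁻¹ ≤ 1 := inv_le_one_of_one_le₀ h3
            calc (2 : ℝ) ^ k₀ * (4 * ((2 : ℝ) ^ k₀)⁻¹) ^ 2 = 16 * ((2 : ℝ) ^ k₀)⁻¹ := by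
                  field_simp; norm_num
              _ ≤ 512 := by linarith
        _ = _ := by rw [ENNReal.ofReal_ofNat, pow_zero]; ring
  have high : ∀ j : ℕ, eLpNorm (lpLowSchwartz φ (k₀ - 2 + j) f -
      lpLowSchwartz φ (k₀ - 2 + j - 1) f) 2 σ ≤ D * ENNReal.ofReal (3 / 4) ^ j * N := by
    intro j
    refine of_sq j ?_
    set k := k₀ - 2 + j with hk
    set F := lpLowSchwartz φ k f - lpLowSchwartz φ (k - 1) f with hF
    have hrep : lpLowSchwartz φ (k + 1) F = F := by
      rw [hF, map_sub, lpLowSchwartz_lpLowSchwartz hφ le_rfl,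
        lpLowSchwartz_lpLowSchwartz hφ (by omega)]
    have hFT : Represents (lpProj φ k T) F := by
      rw [hT, lpProj_toTemperedDistributionCLM]
      exact represents_toTemperedDistributionCLM _
    have hj : (2⁻¹ : ℝ≥0∞) ^ j = ENNReal.ofReal ((2 : ℝ) ^ j)⁻¹ := by
      rw [ENNReal.ofReal_inv_of_pos (by positivity), ENNReal.ofReal_pow (by norm_num),
        ENNReal.ofReal_ofNat, ENNReal.inv_pow]
    have hkj : (2 : ℝ) ^ k = 2 ^ k₀ / 4 * 2 ^ j := by
      rw [hk, zpow_add₀ two_ne_zero, zpow_sub₀ two_ne_zero, zpow_natCast]; norm_num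
    have hkn : (2 : ℝ) ^ (k + 1) = 2 ^ k₀ / 2 * 2 ^ j := by
      rw [zpow_add_one₀ two_ne_zero, hkj]; ring
    rcases le_or_gt k (k₀ + 1) with hkI | hkI
    · refine (trace_ah (k + 1) (by omega) F hrep).trans ?_
      have h1 : ahNorm F ≤ distNorm ahNorm (lpProj φ k T) :=
        le_iInf₂ fun g hg => (ahNorm_congr_ae (hFT.ae_eq hg)).le
      have h2 := critical_le_yStarNorm_sq φ lam T (k := k) (by omega) hkI
      have h3 : ENNReal.ofReal ((2 : ℝ) ^ (k + 1) * 8) ≤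
          512 * 2⁻¹ ^ j * ENNReal.ofReal (Real.sqrt lam) := by
        rw [hj, ← ENNReal.ofReal_ofNat 512, ← ENNReal.ofReal_mul (by norm_num),
          ← ENNReal.ofReal_mul (by positivity)]
        refine ENNReal.ofReal_le_ofReal ?_
        have h4 := (critScale_spec hl).1
        rw [zpow_sub_one₀ two_ne_zero] at h4
        -- Only `j ≤ 3` is critical, so the formal decay `2^(-j)` costs just a factor `64` and all
        -- pieces share one geometric bound.
        have h5 : (2 : ℝ) ^ j ≤ 8 := by
          have : j ≤ 3 := by omega
          calc (2 : ℝ) ^ j ≤ 2 ^ 3 := pow_le_pow_right₀ (by norm_num) this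
            _ = 8 := by norm_num
        have h6 : (2 : ℝ) ^ j ≤ 64 * ((2 : ℝ) ^ j)⁻¹ := by
          rw [← div_eq_mul_inv, le_div_iff₀ (by positivity)]
          nlinarith [show (0 : ℝ) < 2 ^ j by positivity]
        calc (2 : ℝ) ^ (k + 1) * 8 = 4 * 2 ^ k₀ * 2 ^ j := by rw [hkn]; ring
          _ ≤ 4 * (2 * Real.sqrt lam) * (64 * ((2 : ℝ) ^ j)⁻¹) := by gcongr; linarith
          _ = _ := by ring
      calc _ ≤ C * ENNReal.ofReal (2 ^ (k + 1)) * (8 * distNorm ahNorm (lpProj φ k T) ^ 2) := by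
            gcongr
        _ = C * ENNReal.ofReal (2 ^ (k + 1) * 8) * distNorm ahNorm (lpProj φ k T) ^ 2 := by
            rw [ENNReal.ofReal_mul (by positivity), ENNReal.ofReal_ofNat]; ring
        _ ≤ C * (512 * 2⁻¹ ^ j * ENNReal.ofReal (Real.sqrt lam)) *
            distNorm ahNorm (lpProj φ k T) ^ 2 := by gcongr
        _ = 512 * C * 2⁻¹ ^ j *
            (ENNReal.ofReal (Real.sqrt lam) * distNorm ahNorm (lpProj φ k T) ^ 2) := by ring
        _ ≤ _ := by gcongr
    · refine (trace_L2 (k + 1) (by omega) F hrep).trans ?_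
      have h2 : eLpNorm F 2 volume ≤ ENNReal.ofReal (4 * ((2 : ℝ) ^ k)⁻¹) * N := by
        refine (eLpNorm_le_distNorm hFT).trans ((distNorm_lpProj_le hφ hl hkI T).trans ?_)
        gcongr
        exact high_le_yStarNorm φ lam T hkI
      calc _ ≤ C * ENNReal.ofReal (2 ^ (k + 1)) *
            (ENNReal.ofReal (4 * ((2 : ℝ) ^ k)⁻¹) * N) ^ 2 := by gcongr
        _ = C * ENNReal.ofReal (2 ^ (k + 1) * (4 * ((2 : ℝ) ^ k)⁻¹) ^ 2) * N ^ 2 := by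
            rw [ENNReal.ofReal_mul (p := (2 : ℝ) ^ _) (by positivity),
              ENNReal.ofReal_pow (by positivity)]; ring
        _ ≤ C * ENNReal.ofReal (512 * ((2 : ℝ) ^ j)⁻¹) * N ^ 2 := by
            refine mul_le_mul' (mul_le_mul' le_rfl (ENNReal.ofReal_le_ofReal ?_)) le_rfl
            have h3 : (1 : ℝ) ≤ 2 ^ k₀ := one_le_zpow₀ (by norm_num) (by omega)
            have h4 : ((2 : ℝ) ^ k₀)⁻¹ ≤ 1 := inv_le_one_of_one_le₀ h3
            calc (2 : ℝ) ^ (k + 1) * (4 * ((2 : ℝ) ^ k)⁻¹) ^ 2 =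
                  128 * ((2 : ℝ) ^ k₀)⁻¹ * ((2 : ℝ) ^ j)⁻¹ := by
                  rw [hkn, hkj]; field_simp; norm_num
              _ ≤ 512 * ((2 : ℝ) ^ j)⁻¹ := by refine mul_le_mul_of_nonneg_right ?_ (by positivity); linarith
        _ = _ := by
            rw [ENNReal.ofReal_mul (by norm_num), ← hj, ENNReal.ofReal_ofNat]; ring
  have partial_le : ∀ n : ℕ, eLpNorm (lpLowSchwartz φ (k₀ - 3 + n) f) 2 σ ≤
      D * N + ∑ j ∈ Finset.range n, D * ENNReal.ofReal (3 / 4) ^ j * N := by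
    intro n
    induction n with
    | zero => simpa using low
    | succ n ih =>
      rw [Finset.sum_range_succ, ← add_assoc]
      have e : (lpLowSchwartz φ (k₀ - 3 + (n + 1 : ℕ)) f : EuclideanSpace ℝ (Fin (m + 1)) → ℂ) =
          (lpLowSchwartz φ (k₀ - 3 + n) f : EuclideanSpace ℝ (Fin (m + 1)) → ℂ) +
          (lpLowSchwartz φ (k₀ - 2 + n) f - lpLowSchwartz φ (k₀ - 2 + n - 1) f :
            𝓢(EuclideanSpace ℝ (Fin (m + 1)), ℂ)) := by
        rw [show k₀ - 2 + (n : ℤ) - 1 = k₀ - 3 + n by ring,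
          show k₀ - 3 + ((n + 1 : ℕ) : ℤ) = k₀ - 2 + n by push_cast; ring]
        ext x
        simp
      rw [e]
      refine (eLpNorm_add_le (SchwartzMap.continuous _).aestronglyMeasurable
        (SchwartzMap.continuous _).aestronglyMeasurable (by norm_num)).trans ?_
      exact add_le_add ih (high n)
  have sum_le : ∀ n : ℕ, D * N + ∑ j ∈ Finset.range n, D * ENNReal.ofReal (3 / 4) ^ j * N ≤
      (D * 5 : ℝ≥0) * N := by
    intro n
    rw [← Finset.sum_mul, ← Finset.mul_sum]
    have : ∑ j ∈ Finset.range n, ENNReal.ofReal (3 / 4) ^ j ≤ 4 := by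
      refine (ENNReal.sum_le_tsum _).trans ?_
      rw [ENNReal.tsum_geometric, ← ENNReal.ofReal_one, ← ENNReal.ofReal_sub _ (by norm_num),
        ← ENNReal.ofReal_inv_of_pos (by norm_num)]
      norm_num
    calc _ ≤ D * N + D * 4 * N := by gcongr
      _ = _ := by push_cast; ring
  -- Fatou's lemma on `Γ`; the factor `5` is `1` for the low part plus `∑ (3/4)^j = 4`.
  refine (Lp.eLpNorm_lim_le_liminf_eLpNorm
    (fun n => (lpLowSchwartz φ (k₀ - 3 + n) f).continuous.aestronglyMeasurable) f
    (.of_forall fun x => tendsto_lpLowSchwartz hφ (k₀ - 3) f x)).trans ?_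
  exact Filter.liminf_le_of_frequently_le'
    (.of_forall fun n => (partial_le n).trans (sum_le n))

/-! ### Multiplication by a band-limited function. -/

theorem fourier_eq_zero_of_hatS {d : ℕ} {χ : 𝓢(EuclideanSpace ℝ (Fin d), ℂ)}
    (hχ : tsupport (hatS d χ) ⊆ Metric.closedBall 0 1) {η : EuclideanSpace ℝ (Fin d)}
    (h : 1 < ‖(2 * Real.pi) • η‖) : (𝓕 χ : 𝓢(EuclideanSpace ℝ (Fin d), ℂ)) η = 0 := by
  have h1 : hatS d χ ((2 * Real.pi) • η) = 0 := by
    refine image_eq_zero_of_notMem_tsupport fun hx => ?_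
    exact absurd (mem_closedBall_zero_iff.1 (hχ hx)) h.not_ge
  have h2 : hatS d χ ((2 * Real.pi) • η) = (((2 * Real.pi) ^ (-(d : ℝ) / 2) : ℝ) : ℂ) *
      (𝓕 χ : 𝓢(EuclideanSpace ℝ (Fin d), ℂ)) ((2 * Real.pi)⁻¹ • (2 * Real.pi) • η) := rfl
  rw [inv_smul_smul₀ Real.two_pi_pos.ne', h1] at h2
  refine (mul_eq_zero.1 h2.symm).resolve_left ?_
  exact Complex.ofReal_ne_zero.2 (Real.rpow_pos_of_pos Real.two_pi_pos _).ne'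

/-- Multiplication by a function with frequencies in the unit ball moves frequencies by at most
one. -/
theorem multD_smulLeftCLM_multD_eq_zero {d : ℕ} {χ : 𝓢(EuclideanSpace ℝ (Fin d), ℂ)}
    (hχ : tsupport (hatS d χ) ⊆ Metric.closedBall 0 1) {g₁ g₂ : EuclideanSpace ℝ (Fin d) → ℂ}
    (h₁ : g₁.HasTemperateGrowth) (h₂ : g₂.HasTemperateGrowth)
    (h : ∀ ξ η, g₁ ξ ≠ 0 → g₂ η ≠ 0 → 1 < ‖ξ - η‖) (u : 𝓢'(EuclideanSpace ℝ (Fin d), ℂ)) :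
    multD g₁ (TemperedDistribution.smulLeftCLM ℂ χ (multD g₂ u)) = 0 := by
  ext θ
  simp only [multD, TemperedDistribution.fourierMultiplierCLM_apply_apply,
    TemperedDistribution.smulLeftCLM_apply_apply]
  set κ := SchwartzMap.smulLeftCLM ℂ (fun η : EuclideanSpace ℝ (Fin d) => g₁ ((2 * Real.pi) • η))
    (𝓕⁻ θ) with hκ
  have hc : ∀ c : 𝓢(EuclideanSpace ℝ (Fin d), ℂ),
      𝓕⁻ (𝓕 c : 𝓢(EuclideanSpace ℝ (Fin d), ℂ)) = c := FourierTransform.fourierInv_fourier_eq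
  -- By duality the operators act on a test function in reverse order. Multiplication by `χ` becomes
  -- convolution with `𝓕⁻ χ`, which lives in the unit ball of angular frequencies and cannot link
  -- the two symbols.
  have hconv : 𝓕⁻ (SchwartzMap.smulLeftCLM ℂ χ (𝓕 κ)) =
      SchwartzMap.convolution (ContinuousLinearMap.mul ℂ ℂ) (𝓕⁻ χ) κ := by
    rw [← hc (SchwartzMap.convolution (ContinuousLinearMap.mul ℂ ℂ) (𝓕⁻ χ) κ),
      SchwartzMap.fourier_convolution, FourierTransform.fourier_fourierInv_eq]
    congr 1
    ext η
    rw [SchwartzMap.smulLeftCLM_apply_apply χ.hasTemperateGrowth]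
    rfl
  have hz : SchwartzMap.smulLeftCLM ℂ (fun η : EuclideanSpace ℝ (Fin d) =>
      g₂ ((2 * Real.pi) • η)) (𝓕⁻ (SchwartzMap.smulLeftCLM ℂ χ (𝓕 κ))) = 0 := by
    ext η
    rw [SchwartzMap.smulLeftCLM_apply_apply (hasTemperateGrowth_comp_two_pi h₂), hconv,
      SchwartzMap.convolution_apply, convolution_eq_swap]
    by_cases h0 : g₂ ((2 * Real.pi) • η) = 0
    · simp [h0]
    have : ∀ y, ((ContinuousLinearMap.mul ℂ ℂ)
        ((𝓕⁻ χ : 𝓢(EuclideanSpace ℝ (Fin d), ℂ)) (η - y))) (κ y) = 0 := fun y => by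
      rw [ContinuousLinearMap.mul_apply', hκ,
        SchwartzMap.smulLeftCLM_apply_apply (hasTemperateGrowth_comp_two_pi h₁)]
      by_cases h1 : g₁ ((2 * Real.pi) • y) = 0
      · simp [h1]
      have h3 := h _ _ h1 h0
      rw [← smul_sub] at h3
      have h4 : (𝓕⁻ χ : 𝓢(EuclideanSpace ℝ (Fin d), ℂ)) (η - y) =
          (𝓕 χ : 𝓢(EuclideanSpace ℝ (Fin d), ℂ)) (-(η - y)) := rfl
      rw [h4, neg_sub, fourier_eq_zero_of_hatS hχ h3, zero_mul]
    simp [this]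
  have h0 : 𝓕 (0 : 𝓢(EuclideanSpace ℝ (Fin d), ℂ)) = (0 : 𝓢(EuclideanSpace ℝ (Fin d), ℂ)) :=
    map_zero (FourierTransform.fourierCLM ℂ 𝓢(EuclideanSpace ℝ (Fin d), ℂ))
  rw [hz, h0, map_zero]
  rfl

/-- First-order decay of `χ` already gives `|χ|^2 ≲ (1+|x|)^(-2)`, a weight that is at most one and
is controlled by the Agmon-Hörmander norm. The constant works because `8 ≤ 3^2`. -/
theorem exists_distNorm_smulLeftCLM_le {d : ℕ} (χ : 𝓢(EuclideanSpace ℝ (Fin d), ℂ)) :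
    ∃ C : ℝ≥0, 0 < C ∧ ∀ T : 𝓢'(EuclideanSpace ℝ (Fin d), ℂ),
      distNorm (fun g => eLpNorm g 2 volume) (TemperedDistribution.smulLeftCLM ℂ χ T) ≤
        C * distNorm (fun g => eLpNorm g 2 volume) T ∧
      distNorm (fun g => eLpNorm g 2 volume) (TemperedDistribution.smulLeftCLM ℂ χ T) ≤
        C * distNorm ahNorm T := by
  obtain ⟨C₀, hC₀⟩ : ∃ C : ℝ≥0, ∀ x, (1 + ‖x‖) ^ 1 * ‖χ x‖ ≤ C := by
    have h := fun x => SchwartzMap.one_add_le_sup_seminorm_apply (𝕜 := ℝ) (m := (1, 0)) le_rfl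
      le_rfl χ x
    simp only [norm_iteratedFDeriv_zero] at h
    exact ⟨⟨_, le_trans (by positivity) (h 0)⟩, h⟩
  have hχ : ∀ x, ‖χ x‖ₑ ^ 2 ≤ C₀ ^ 2 * ENNReal.ofReal (((1 + ‖x‖) ^ 2)⁻¹) := fun x => by
    rw [← ofReal_norm, ← ENNReal.ofReal_pow (norm_nonneg _), ← ENNReal.ofReal_coe_nnreal,
      ← ENNReal.ofReal_pow C₀.coe_nonneg, ← ENNReal.ofReal_mul (by positivity)]
    refine ENNReal.ofReal_le_ofReal ?_
    rw [← div_eq_mul_inv, le_div_iff₀ (by positivity), ← mul_pow, mul_comm]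
    have := hC₀ x
    rw [pow_one] at this
    gcongr
  have key : ∀ (T : 𝓢'(EuclideanSpace ℝ (Fin d), ℂ)) (g : EuclideanSpace ℝ (Fin d) → ℂ),
      Represents T g → distNorm (fun g => eLpNorm g 2 volume)
        (TemperedDistribution.smulLeftCLM ℂ χ T) ^ 2 ≤
        C₀ ^ 2 * ∫⁻ x, ENNReal.ofReal (((1 + ‖x‖) ^ 2)⁻¹) * ‖g x‖ₑ ^ 2 := by
    intro T g hg
    refine (pow_le_pow_left' (distNorm_le (hg.smulLeftCLM χ.hasTemperateGrowth)) 2).trans ?_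
    rw [eLpNorm_two_sq, ← lintegral_const_mul' _ _ (by finiteness)]
    refine lintegral_mono fun x => ?_
    rw [enorm_mul, mul_pow, ← mul_assoc]
    gcongr
    exact hχ x
  have hpos : (0 : ℝ≥0) < 3 * C₀ + 1 := by positivity
  refine ⟨3 * C₀ + 1, hpos, fun T => ⟨?_, ?_⟩⟩
  · refine le_mul_distNorm (by simp) ENNReal.coe_ne_top fun g hg => ?_
    rw [← ENNReal.pow_le_pow_left_iff two_ne_zero, mul_pow, eLpNorm_two_sq]
    refine (key T g hg).trans (mul_le_mul' ?_ (lintegral_mono fun y => ?_))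
    · gcongr
      have : C₀ ≤ 3 * C₀ + 1 := by
        rw [← NNReal.coe_le_coe]; push_cast; linarith [C₀.2]
      exact_mod_cast this
    · exact mul_le_of_le_one_left' (lowWeight_le_one y)
  · refine le_mul_distNorm (by simp) ENNReal.coe_ne_top fun g hg => ?_
    rw [← ENNReal.pow_le_pow_left_iff two_ne_zero, mul_pow]
    refine (key T g hg).trans ?_
    calc _ ≤ (C₀ : ℝ≥0∞) ^ 2 * (8 * ahNorm g ^ 2) := by
          gcongr; exact lintegral_weight_le_ahNorm g
      _ = (8 * C₀ ^ 2 : ℝ≥0) * ahNorm g ^ 2 := by push_cast; ring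
      _ ≤ _ := by
          gcongr
          have : 8 * C₀ ^ 2 ≤ (3 * C₀ + 1) ^ 2 := by
            rw [← NNReal.coe_le_coe]; push_cast; nlinarith [C₀.2, NNReal.coe_nonneg C₀]
          exact_mod_cast this

/-! ### Two-sided geometric sums and half-integer powers of two. -/

theorem tsum_int_natAbs_sub_le (f : ℕ → ℝ≥0∞) (a : ℤ) :
    ∑' l : ℤ, f (l - a).natAbs ≤ 2 * ∑' n, f n := by
  have e := (Equiv.subRight a).tsum_eq (fun l : ℤ => f l.natAbs)
  simp only [Equiv.subRight_apply] at e
  rw [e, tsum_of_nat_of_neg_add_one ENNReal.summable ENNReal.summable, two_mul]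
  refine add_le_add le_rfl ?_
  have : ∀ n : ℕ, (-((n : ℤ) + 1)).natAbs = n + 1 := fun n => by omega
  simp only [this]
  exact ENNReal.tsum_comp_le_tsum_of_injective (add_left_injective 1) f

theorem sqrt_two_zpow_two_mul (k : ℤ) : Real.sqrt 2 ^ (2 * k) = 2 ^ k := by
  rw [zpow_mul]
  congr 1
  exact_mod_cast Real.sq_sqrt (zero_le_two (α := ℝ))

theorem two_rpow_half_eq (l : ℤ) :
    (2 : ℝ≥0∞) ^ ((l : ℝ) / 2) = ENNReal.ofReal (Real.sqrt 2 ^ l) := by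
  rw [← ENNReal.ofReal_ofNat, ENNReal.ofReal_rpow_of_pos two_pos, Real.sqrt_eq_rpow,
    ← Real.rpow_intCast, ← Real.rpow_mul two_pos.le]
  congr 2; ring

theorem sqrt_two_zpow_neg_natCast_le (n : ℕ) : Real.sqrt 2 ^ (-(n : ℤ)) ≤ (3 / 4) ^ n := by
  rw [zpow_neg, zpow_natCast, ← inv_pow]
  gcongr
  have h : (4 / 3 : ℝ) ≤ Real.sqrt 2 := Real.le_sqrt_of_sq_le (by norm_num)
  calc (Real.sqrt 2)⁻¹ ≤ (4 / 3)⁻¹ := by gcongr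
    _ = 3 / 4 := by norm_num

theorem one_lt_sqrt_two : 1 < Real.sqrt 2 := by
  rw [Real.lt_sqrt zero_le_one]; norm_num

/-! ### Frequency localisation of `P_l(χu)`. -/

section Localization

variable {d : ℕ} {φ χ : 𝓢(EuclideanSpace ℝ (Fin d), ℂ)}

/-- The two supports are more than `2^l/2 - 2^l/4 ≥ 2` apart. -/
theorem lpProj_smulLeftCLM_low_eq_zero (hφ : IsLPBase φ)
    (hχ : tsupport (hatS d χ) ⊆ Metric.closedBall 0 1) {l : ℤ} (hl : 3 ≤ l)
    (u : 𝓢'(EuclideanSpace ℝ (Fin d), ℂ)) :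
    lpProj φ l (TemperedDistribution.smulLeftCLM ℂ χ (lpLow φ (l - 3) u)) = 0 := by
  refine multD_smulLeftCLM_multD_eq_zero hχ (annSymbol_hasTemperateGrowth φ l)
    (lowSymbol_hasTemperateGrowth φ (l - 3)) (fun ξ η h1 h2 => ?_) u
  have h1' := not_le.1 fun h => h1 (annSymbol_eq_zero_of_le hφ h)
  have h2' := not_lt.1 fun h => h2 (lowSymbol_eq_zero hφ h)
  have h3 : (2 : ℝ) ^ (l - 3) = 2 ^ l / 8 := by rw [zpow_sub₀ two_ne_zero]; norm_num
  have h4 : (2 : ℝ) ^ (3 : ℤ) ≤ 2 ^ l := zpow_le_zpow_right₀ (by norm_num) hl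
  have h5 := norm_sub_norm_le ξ η
  norm_num at h4
  linarith

/-- The discarded part of `u` has frequencies above `2^n`, while `P_l` sees only those up to
`2^(l+1) ≤ 2^n/2`; the gap exceeds `2^n/2 ≥ 1`. -/
theorem lpProj_smulLeftCLM_eq_of_le (hφ : IsLPBase φ)
    (hχ : tsupport (hatS d χ) ⊆ Metric.closedBall 0 1) {l n : ℤ} (hn : 1 ≤ n) (hl : l + 2 ≤ n)
    (u : 𝓢'(EuclideanSpace ℝ (Fin d), ℂ)) :
    lpProj φ l (TemperedDistribution.smulLeftCLM ℂ χ u) =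
      lpProj φ l (TemperedDistribution.smulLeftCLM ℂ χ (lpLow φ n u)) := by
  have h1 : (fun _ : EuclideanSpace ℝ (Fin d) => (1 : ℂ)).HasTemperateGrowth := by fun_prop
  have hlow := lowSymbol_hasTemperateGrowth φ n
  have hone : multD (fun _ : EuclideanSpace ℝ (Fin d) => (1 : ℂ)) u = u := by
    rw [multD, TemperedDistribution.fourierMultiplierCLM_const, one_smul]; rfl
  have e : u - lpLow φ n u = multD ((fun _ => 1) - lowSymbol φ n) u := by
    rw [multD_sub h1 hlow, hone]; rfl
  rw [← sub_eq_zero, ← map_sub, ← map_sub, e]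
  refine multD_smulLeftCLM_multD_eq_zero hχ (annSymbol_hasTemperateGrowth φ l)
    (h1.sub hlow) (fun ξ η h1 h2 => ?_) u
  have h1' := not_lt.1 fun h => h1 (annSymbol_eq_zero_of_lt hφ h)
  have h2' : (2 : ℝ) ^ n < ‖η‖ := by
    by_contra! h
    exact h2 (by simp [lowSymbol_eq_one hφ h])
  have h3 : (2 : ℝ) ^ l * 4 ≤ 2 ^ n := by
    calc (2 : ℝ) ^ l * 4 = 2 ^ (l + 2) := by rw [zpow_add₀ two_ne_zero]; norm_num
      _ ≤ _ := zpow_le_zpow_right₀ (by norm_num) hl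
  have h4 : (2 : ℝ) ^ (1 : ℤ) ≤ 2 ^ n := zpow_le_zpow_right₀ (by norm_num) hn
  have h5 := norm_sub_norm_le η ξ
  rw [norm_sub_rev] at h5
  norm_num at h4
  linarith

end Localization

/-! ### Summation over scales: the Besov estimate. -/

/-- The localized Besov estimate for the space `Y_λ^*`. -/
theorem exists_besovSeminorm_le {d : ℕ} (φ : 𝓢(EuclideanSpace ℝ (Fin d), ℂ)) (hφ : IsLPBase φ)
    (χ : 𝓢(EuclideanSpace ℝ (Fin d), ℂ)) (hχ : tsupport (hatS d χ) ⊆ Metric.closedBall 0 1) :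
    ∃ C : ℝ≥0, 0 < C ∧ ∀ lam : ℝ, 1 < lam → ∀ u : 𝓢'(EuclideanSpace ℝ (Fin d), ℂ),
      besovSeminorm φ (TemperedDistribution.smulLeftCLM ℂ χ u) ≤ C * yStarNorm φ lam u := by
  obtain ⟨B, hB, -, hφB⟩ := exists_norm_symbol_le φ
  obtain ⟨C₁, hC₁, hχC⟩ := exists_distNorm_smulLeftCLM_le χ
  set B' : ℝ≥0 := ⟨B, hB.le⟩ with hB'
  have hB'0 : 0 < B' := hB
  refine ⟨B' * C₁ * 192 * 8, by positivity, fun lam hlam u => ?_⟩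
  have hl : 0 < lam := zero_lt_one.trans hlam
  set N := yStarNorm φ lam u with hN
  set k₀ := critScale lam with hk₀
  have hk1 : 1 ≤ k₀ := one_le_critScale hlam
  -- Writing `2^(l/2)` as `s^l` keeps every exponent an integer.
  set s := Real.sqrt 2 with hs
  have hs1 : 1 < s := one_lt_sqrt_two
  have hs0 : 0 < s := zero_lt_one.trans hs1
  set S : 𝓢'(EuclideanSpace ℝ (Fin d), ℂ) → ℝ≥0∞ := fun T =>
    distNorm (fun g => eLpNorm g 2 volume) (TemperedDistribution.smulLeftCLM ℂ χ T) with hS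
  have S_add : ∀ T T', S (T + T') ≤ S T + S T' := fun T T' => by
    simp only [hS, map_add]; exact distNorm_add_le _ _
  have proj_le : ∀ l T, distNorm (fun g => eLpNorm g 2 volume)
      (lpProj φ l (TemperedDistribution.smulLeftCLM ℂ χ T)) ≤ B' * S T := fun l T => by
    have := distNorm_multD_le (annSymbol_hasTemperateGrowth φ l) hB (hφB l)
      (TemperedDistribution.smulLeftCLM ℂ χ T)
    rwa [show ENNReal.ofReal B = B' from ENNReal.ofReal_eq_coe_nnreal hB.le] at this
  have high : ∀ k, k₀ + 1 < k → S (lpProj φ k u) ≤ C₁ * ENNReal.ofReal (4 * s ^ (-2 * k)) * N := by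
    intro k hk
    refine (hχC _).1.trans ?_
    rw [mul_assoc]
    gcongr
    refine (distNorm_lpProj_le hφ hl hk u).trans ?_
    rw [neg_mul, zpow_neg, sqrt_two_zpow_two_mul]
    gcongr
    exact high_le_yStarNorm φ lam u hk
  have low : S (lpLow φ (k₀ - 3) u) ≤ C₁ * ENNReal.ofReal (4 * s ^ (-k₀)) * N := by
    refine (hχC _).1.trans ?_
    rw [mul_assoc]
    gcongr
    refine (distNorm_lpLow_le hφ hl u).trans ?_
    refine mul_le_mul' (ENNReal.ofReal_le_ofReal ?_) (low_le_yStarNorm φ lam u)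
    rw [← sqrt_two_zpow_two_mul, ← zpow_neg]
    gcongr
    · exact hs1.le
    · omega
  have crit : ∀ k, k₀ - 2 ≤ k → k ≤ k₀ + 1 →
      S (lpProj φ k u) ≤ C₁ * ENNReal.ofReal (4 * s ^ (-k₀)) * N := by
    intro k hk hk'
    refine (hχC _).2.trans ?_
    rw [mul_assoc]
    gcongr
    set X := distNorm ahNorm (lpProj φ k u) with hX
    have h1 : ENNReal.ofReal (s ^ k₀) * X ≤ 2 * N := by
      rw [← ENNReal.pow_le_pow_left_iff two_ne_zero, mul_pow, mul_pow,
        ← ENNReal.ofReal_pow (by positivity)]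
      have h2 : (s ^ k₀) ^ 2 ≤ 2 * Real.sqrt lam := by
        have h3 := (critScale_spec hl).1
        rw [zpow_sub_one₀ two_ne_zero] at h3
        rw [← zpow_natCast, ← zpow_mul, mul_comm k₀, Nat.cast_ofNat, sqrt_two_zpow_two_mul]
        linarith
      calc _ ≤ ENNReal.ofReal (2 * Real.sqrt lam) * X ^ 2 := by gcongr
        _ = 2 * (ENNReal.ofReal (Real.sqrt lam) * X ^ 2) := by
            rw [ENNReal.ofReal_mul two_pos.le, ENNReal.ofReal_ofNat, mul_assoc]
        _ ≤ 2 * N ^ 2 := by gcongr; exact critical_le_yStarNorm_sq φ lam u hk hk'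
        _ ≤ 2 ^ 2 * N ^ 2 := by gcongr; norm_num
    calc X = ENNReal.ofReal (s ^ (-k₀)) * (ENNReal.ofReal (s ^ k₀) * X) := by
          rw [← mul_assoc, ← ENNReal.ofReal_mul (by positivity), ← zpow_add₀ hs0.ne',
            neg_add_cancel, zpow_zero, ENNReal.ofReal_one, one_mul]
      _ ≤ ENNReal.ofReal (s ^ (-k₀)) * (2 * N) := by gcongr
      _ = ENNReal.ofReal (2 * s ^ (-k₀)) * N := by
          rw [ENNReal.ofReal_mul two_pos.le, ENNReal.ofReal_ofNat]; ring
      _ ≤ _ := by gcongr; norm_num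
  have all : ∀ k, k₀ - 2 ≤ k → S (lpProj φ k u) ≤ C₁ * ENNReal.ofReal (4 * s ^ (-k₀)) * N := by
    intro k hk
    rcases le_or_gt k (k₀ + 1) with h | h
    · exact crit k hk h
    · refine (high k h).trans ?_
      gcongr
      · exact hs1.le
      · omega
  -- A finite telescoping sum, so no convergence of the Littlewood-Paley series of `u` is ever used.
  have step : ∀ n : ℕ, S (lpLow φ (k₀ - 3 + n) u) ≤
      (n + 1) * (C₁ * ENNReal.ofReal (4 * s ^ (-k₀)) * N) := by
    intro n
    induction n with
    | zero => simpa using low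
    | succ n ih =>
      have e : lpLow φ (k₀ - 3 + (n + 1 : ℕ)) u =
          lpLow φ (k₀ - 3 + n) u + lpProj φ (k₀ - 2 + n) u := by
        rw [lpProj_eq_sub, show k₀ - 2 + (n : ℤ) - 1 = k₀ - 3 + n by ring,
          show k₀ - 3 + ((n + 1 : ℕ) : ℤ) = k₀ - 2 + n by push_cast; ring]
        abel
      rw [e]
      refine (S_add _ _).trans ((add_le_add ih (all _ (by omega))).trans (le_of_eq ?_))
      push_cast; ring
  have term : ∀ l : ℤ, (2 : ℝ≥0∞) ^ ((l : ℝ) / 2) * distNorm (fun g => eLpNorm g 2 volume)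
      (lpProj φ l (TemperedDistribution.smulLeftCLM ℂ χ u)) ≤
      (B' * C₁ * 192 : ℝ≥0) * N * ENNReal.ofReal (3 / 4) ^ (l - (k₀ + 4)).natAbs := by
    intro l
    rw [two_rpow_half_eq, ← ENNReal.ofReal_pow (by norm_num)]
    have hdec := sqrt_two_zpow_neg_natCast_le (l - (k₀ + 4)).natAbs
    rcases le_or_gt l (k₀ + 4) with h | h
    -- The cutoff `k₀ + 8` leaves ample room above `l + 2 ≤ k₀ + 6`. Its twelve pieces, each with
    -- constant `4`, give `48`, and re-centring at `k₀ + 4` costs `s^4 = 4`, whence `192`.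
    · rw [lpProj_smulLeftCLM_eq_of_le hφ hχ (n := k₀ - 3 + (11 : ℕ)) (by omega) (by omega)]
      have hr : s ^ l * (48 * s ^ (-k₀)) ≤ 192 * (3 / 4) ^ (l - (k₀ + 4)).natAbs := by
        have e : -(((l - (k₀ + 4)).natAbs : ℕ) : ℤ) = l - k₀ - 4 := by omega
        have h4 : s ^ (4 : ℤ) = 4 := by
          rw [show (4 : ℤ) = 2 * 2 by norm_num, sqrt_two_zpow_two_mul]; norm_num
        rw [e] at hdec
        calc s ^ l * (48 * s ^ (-k₀)) = 48 * s ^ (4 : ℤ) * s ^ (l - k₀ - 4) := by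
              rw [mul_assoc 48, ← zpow_add₀ hs0.ne', mul_left_comm, ← zpow_add₀ hs0.ne']
              congr 2; ring
          _ ≤ _ := by rw [h4]; linarith
      calc _ ≤ ENNReal.ofReal (s ^ l) * (B' * (((11 : ℕ) + 1) *
            (C₁ * ENNReal.ofReal (4 * s ^ (-k₀)) * N))) := by
            gcongr
            exact (proj_le _ _).trans (by gcongr; exact step 11)
        _ = B' * C₁ * N * ENNReal.ofReal (s ^ l * (48 * s ^ (-k₀))) := by
            rw [ENNReal.ofReal_mul (p := s ^ l) (by positivity),
              show (48 : ℝ) * s ^ (-k₀) = 12 * (4 * s ^ (-k₀)) by ring,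
              ENNReal.ofReal_mul (p := 12) (by norm_num), ENNReal.ofReal_ofNat]
            push_cast
            norm_num
            ring
        _ ≤ B' * C₁ * N * ENNReal.ofReal (192 * (3 / 4) ^ (l - (k₀ + 4)).natAbs) := by gcongr
        _ = _ := by
            rw [ENNReal.ofReal_mul (by norm_num), ENNReal.ofReal_ofNat]; push_cast; ring
    -- All five neighbours are noncritical, since `l - 2 > k₀ + 1`; hence the strong bound `high`
    -- applies to each.
    · have e : lpProj φ l (TemperedDistribution.smulLeftCLM ℂ χ u) =
          lpProj φ l (TemperedDistribution.smulLeftCLM ℂ χ (lpProj φ (l - 2) u +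
            (lpProj φ (l - 1) u + (lpProj φ l u + (lpProj φ (l + 1) u + lpProj φ (l + 2) u))))) := by
        rw [lpProj_smulLeftCLM_eq_of_le hφ hχ (n := l + 2) (by omega) le_rfl,
          ← sub_zero (lpProj φ l (TemperedDistribution.smulLeftCLM ℂ χ (lpLow φ (l + 2) u))),
          ← lpProj_smulLeftCLM_low_eq_zero hφ hχ (l := l) (by omega) u, ← map_sub, ← map_sub]
        congr 2
        rw [lpProj_eq_sub φ (l - 2), lpProj_eq_sub φ (l - 1), lpProj_eq_sub φ l,
          lpProj_eq_sub φ (l + 1), lpProj_eq_sub φ (l + 2),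
          show l - 2 - 1 = l - 3 by ring, show l - 1 - 1 = l - 2 by ring,
          show l + 1 - 1 = l by ring, show l + 2 - 1 = l + 1 by ring]
        abel
      have hk : ∀ k, l - 2 ≤ k → S (lpProj φ k u) ≤
          C₁ * ENNReal.ofReal (16 * s ^ (-2 * l)) * N := fun k hk => by
        refine (high k (by omega)).trans ?_
        refine mul_le_mul' (mul_le_mul' le_rfl (ENNReal.ofReal_le_ofReal ?_)) le_rfl
        have h4 : s ^ (4 : ℤ) = 4 := by
          rw [show (4 : ℤ) = 2 * 2 by norm_num, sqrt_two_zpow_two_mul]; norm_num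
        calc 4 * s ^ (-2 * k) ≤ 4 * s ^ (4 + -2 * l) := by
              gcongr
              · exact hs1.le
              · omega
          _ = _ := by rw [zpow_add₀ hs0.ne', h4]; ring
      have hr : s ^ l * (80 * s ^ (-2 * l)) ≤ 192 * (3 / 4) ^ (l - (k₀ + 4)).natAbs := by
        have e : -(((l - (k₀ + 4)).natAbs : ℕ) : ℤ) = -l + k₀ + 4 := by omega
        rw [e] at hdec
        calc s ^ l * (80 * s ^ (-2 * l)) = 80 * s ^ (-l) := by
              rw [mul_left_comm, ← zpow_add₀ hs0.ne']; congr 2; ring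
          _ ≤ 192 * s ^ (-l + k₀ + 4) := by
              gcongr
              · norm_num
              · exact hs1.le
              · omega
          _ ≤ _ := by gcongr
      rw [e]
      calc _ ≤ ENNReal.ofReal (s ^ l) * (B' * (5 *
            (C₁ * ENNReal.ofReal (16 * s ^ (-2 * l)) * N))) := by
            gcongr
            refine (proj_le _ _).trans ?_
            gcongr
            refine (S_add _ _).trans ((add_le_add (hk _ le_rfl) ((S_add _ _).trans
              (add_le_add (hk _ (by omega)) ((S_add _ _).trans (add_le_add (hk _ (by omega))
              ((S_add _ _).trans (add_le_add (hk _ (by omega)) (hk _ (by omega))))))))).trans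
              (le_of_eq ?_))
            ring
        _ = B' * C₁ * N * ENNReal.ofReal (s ^ l * (80 * s ^ (-2 * l))) := by
            rw [ENNReal.ofReal_mul (p := s ^ l) (by positivity),
              show (80 : ℝ) * s ^ (-2 * l) = 5 * (16 * s ^ (-2 * l)) by ring,
              ENNReal.ofReal_mul (p := 5) (by norm_num), ENNReal.ofReal_ofNat]
            ring
        _ ≤ B' * C₁ * N * ENNReal.ofReal (192 * (3 / 4) ^ (l - (k₀ + 4)).natAbs) := by gcongr
        _ = _ := by
            rw [ENNReal.ofReal_mul (by norm_num), ENNReal.ofReal_ofNat]; push_cast; ring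
  calc besovSeminorm φ (TemperedDistribution.smulLeftCLM ℂ χ u)
      ≤ ∑' l : ℤ, (B' * C₁ * 192 : ℝ≥0) * N *
        ENNReal.ofReal (3 / 4) ^ (l - (k₀ + 4)).natAbs := ENNReal.tsum_le_tsum term
    _ ≤ (B' * C₁ * 192 : ℝ≥0) * N * (2 * 4) := by
        rw [ENNReal.tsum_mul_left]
        gcongr
        refine (tsum_int_natAbs_sub_le (fun n => ENNReal.ofReal (3 / 4) ^ n) (k₀ + 4)).trans ?_
        gcongr
        rw [ENNReal.tsum_geometric, ← ENNReal.ofReal_one, ← ENNReal.ofReal_sub _ (by norm_num),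
          ← ENNReal.ofReal_inv_of_pos (by norm_num)]
        norm_num
    _ = _ := by push_cast; ring

theorem mainTheorem5 {d : ℕ} (hd : 2 ≤ d) (φ : 𝓢(EuclideanSpace ℝ (Fin d), ℂ))
    (hφ : IsLPBase φ) :
    (∀ Γ : Set (EuclideanSpace ℝ (Fin d)), IsCompact Γ → IsLipschitzHypersurface Γ →
      ∃ C : ℝ≥0, 0 < C ∧ ∀ lam : ℝ, 1 < lam → ∀ f : 𝓢(EuclideanSpace ℝ (Fin d), ℂ),
        eLpNorm f 2 (surfaceMeasure Γ) ≤
          C * yStarNorm φ lam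
            (SchwartzMap.toTemperedDistributionCLM (EuclideanSpace ℝ (Fin d)) ℂ volume f)) ∧
    (∀ χ : 𝓢(EuclideanSpace ℝ (Fin d), ℂ), tsupport (hatS d χ) ⊆ Metric.closedBall 0 1 →
      ∃ C : ℝ≥0, 0 < C ∧ ∀ lam : ℝ, 1 < lam → ∀ u ∈ YStar φ lam,
        besovSeminorm φ (TemperedDistribution.smulLeftCLM ℂ χ u) ≤
          C * yStarNorm φ lam u) := by
  refine ⟨fun Γ hc hΓ => exists_eLpNorm_surfaceMeasure_le hd φ hφ hc hΓ, fun χ hχ => ?_⟩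
  obtain ⟨C, hC, h⟩ := exists_besovSeminorm_le φ hφ χ hχ
  exact ⟨C, hC, fun lam hlam u _ => h lam hlam u⟩
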